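/- Let $H^n([0,1])=W^{n,2}([0,1])$ denote the Sobolev space of functions on $[0,1]$ whose weak derivatives of order at most $n$ lie in $L^2(0,1)$, let $H^2_0([0,1])$ be the Hilbert space of all $f\in H^2([0,1])$ with $f(0)=f(1)=f'(0)=f'(1)=0$, with inner product $\langle u,v\rangle_{H_0^2}=\int_0^1\partial_{xx}u\,\partial_{xx}v\,dx$, and let $$\mathrm{Diff}_0^2([0,1])=\{\mathrm{Id}+f : f\in H^2_0([0,1]),\ 1+f'(x)>0 \text{ for all } x\in[0,1]\},$$ which is an open subset of the affine space $\mathrm{Id}+H_0^2([0,1])$, endowed with the right-invariant Riemannian metric $$G_\varphi(X,Y)=\langle X\circ\varphi^{-1},Y\circ\varphi^{-1}\rangle_{H_0^2},\qquad X,Y\in T_\varphi\mathrm{Diff}_0^2([0,1])=H_0^2([0,1]).$$ A geodesic is a $C^1$ curve $\varphi:[0,1]\to\mathrm{Diff}_0^2([0,1])$ which is a critical point of the energy $\frac12\int_0^1G_{\varphi(t)}(\dot\varphi(t),\dot\varphi(t))\,dt$ with respect to smooth variations $\varphi+sh$, where $h:\mathbb R\to H_0^2([0,1])$ is smooth with $h(0)=h(1)=0$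 and $s$ is small. Let $n\ge 3$ be an integer and let $\varphi_1\in\mathrm{Diff}_0^2([0,1])$ belong to $H^n([0,1])$. Then for every geodesic $\varphi$ with $\varphi(0)=\mathrm{Id}$ and $\varphi(1)=\varphi_1$, the initial tangent vector $\dot\varphi(0)$ lies in $H^n([0,1])$. -/

import Mathlib

open MeasureTheory Set
open scoped ContDiff

namespace SobolevDiff

noncomputable section

/-- Smooth test functions with compact support in the open interval `(0,1)`. -/
structure IsTest (ψ : ℝ → ℝ) : Prop where
  smooth : ContDiff ℝ ∞ ψ
  compact : HasCompactSupport ψ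
  supp : tsupport ψ ⊆ Ioo 0 1

/-- Lebesgue measure on `(0,1)`. -/
abbrev μI : Measure ℝ := volume.restrict (Ioo 0 1)

/-- `g` is a weak derivative of order `k` of `f` on `(0,1)`. -/
def IsWeakDeriv (k : ℕ) (f g : ℝ → ℝ) : Prop :=
  ∀ ψ : ℝ → ℝ, IsTest ψ →
    ∫ x, f x * iteratedDeriv k ψ x ∂μI = (-1) ^ k * ∫ x, g x * ψ x ∂μI

/-- The Sobolev space `H^n([0,1]) = W^{n,2}([0,1])`: `f` is in `L^2(0,1)` and its weak derivatives
of order at most `n` exist in `L^2(0,1)`. Only the restriction of `f` to `(0,1)` matters. -/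
def MemH (n : ℕ) (f : ℝ → ℝ) : Prop :=
  MemLp f 2 μI ∧ ∀ k ≤ n, ∃ g : ℝ → ℝ, MemLp g 2 μI ∧ IsWeakDeriv k f g

open Classical in
/-- The weak second derivative `∂ₓₓ f`, as an element of `L^2(0,1)`
(and `0` if there is none in `L^2(0,1)`). -/
def weakD2 (f : ℝ → ℝ) : Lp ℝ 2 μI :=
  if h : ∃ g : Lp ℝ 2 μI, IsWeakDeriv 2 f g then h.choose else 0

/-- The bilinear form `⟨u, v⟩ = ∫₀¹ ∂ₓₓ u ∂ₓₓ v dx`. -/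
def innerH02 (u v : ℝ → ℝ) : ℝ := ∫ x, weakD2 u x * weakD2 v x ∂μI

/-! ### Helper facts on test functions and weak derivatives -/

lemma IsTest.iteratedDeriv_cont {ψ : ℝ → ℝ} (h : IsTest ψ) (k : ℕ) :
    Continuous (iteratedDeriv k ψ) :=
  h.smooth.continuous_iteratedDeriv k (by exact_mod_cast le_top)

lemma IsTest.deriv {ψ : ℝ → ℝ} (h : IsTest ψ) : IsTest (deriv ψ) where
  smooth := ((contDiff_infty_iff_deriv).1 h.smooth).2
  compact := h.compact.deriv
  supp := (tsupport_deriv_subset (𝕜 := ℝ)).trans h.supp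

lemma IsTest.iteratedDeriv {ψ : ℝ → ℝ} (h : IsTest ψ) (k : ℕ) : IsTest (iteratedDeriv k ψ) := by
  induction k with
  | zero => simpa using h
  | succ k ih => rw [iteratedDeriv_succ]; exact ih.deriv

lemma IsTest.memLp {ψ : ℝ → ℝ} (h : IsTest ψ) : MemLp ψ 2 μI :=
  (h.smooth.continuous.memLp_of_hasCompactSupport h.compact).restrict _

lemma integrable_mul_test {f ψ : ℝ → ℝ} (hf : MemLp f 2 μI) (h : IsTest ψ) :
    Integrable (fun x => f x * ψ x) μI :=
  hf.integrable_mul h.memLp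

lemma IsWeakDeriv.add {k : ℕ} {f₁ f₂ g₁ g₂ : ℝ → ℝ} (hf₁ : MemLp f₁ 2 μI) (hf₂ : MemLp f₂ 2 μI)
    (hg₁ : MemLp g₁ 2 μI) (hg₂ : MemLp g₂ 2 μI) (h₁ : IsWeakDeriv k f₁ g₁)
    (h₂ : IsWeakDeriv k f₂ g₂) : IsWeakDeriv k (f₁ + f₂) (g₁ + g₂) := by
  intro ψ hψ
  simp only [Pi.add_apply, add_mul]
  rw [integral_add (integrable_mul_test hf₁ (hψ.iteratedDeriv k))
    (integrable_mul_test hf₂ (hψ.iteratedDeriv k)),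
    integral_add (integrable_mul_test hg₁ hψ) (integrable_mul_test hg₂ hψ), h₁ ψ hψ, h₂ ψ hψ]
  ring

lemma IsWeakDeriv.smul {k : ℕ} {f g : ℝ → ℝ} (c : ℝ) (h : IsWeakDeriv k f g) :
    IsWeakDeriv k (c • f) (c • g) := by
  intro ψ hψ
  simp only [Pi.smul_apply, smul_eq_mul, mul_assoc]
  rw [integral_const_mul, integral_const_mul, h ψ hψ]
  ring

lemma IsWeakDeriv.congr {k : ℕ} {f g g' : ℝ → ℝ} (h : IsWeakDeriv k f g) (hg : g =ᵐ[μI] g') :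
    IsWeakDeriv k f g' := by
  intro ψ hψ
  rw [h ψ hψ]
  congr 1
  apply integral_congr_ae
  filter_upwards [hg] with x hx
  rw [hx]

lemma ae_zero_of_test {g : ℝ → ℝ} (hg : MemLp g 2 μI)
    (h : ∀ ψ, IsTest ψ → ∫ x, g x * ψ x ∂μI = 0) : g =ᵐ[μI] 0 := by
  have hi : IntegrableOn g (Ioo 0 1) volume := hg.integrable (by norm_num)
  have key := isOpen_Ioo.ae_eq_zero_of_integral_contDiff_smul_eq_zero
    (μ := volume) (f := g) (U := Ioo (0 : ℝ) 1) hi.locallyIntegrableOn ?_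
  · exact (ae_restrict_iff' measurableSet_Ioo).2 key
  · intro ψ h1 h2 h3
    have := h ψ ⟨h1, h2, h3⟩
    rw [← this, ← integral_indicator measurableSet_Ioo]
    apply integral_congr_ae
    refine Filter.Eventually.of_forall fun x => ?_
    by_cases hx : x ∈ Ioo (0 : ℝ) 1
    · simp [hx, mul_comm]
    · have : ψ x = 0 := image_eq_zero_of_notMem_tsupport fun h => hx (h3 h)
      simp [hx, this]

lemma weakD2_unique {f : ℝ → ℝ} {g₁ g₂ : Lp ℝ 2 μI} (h₁ : IsWeakDeriv 2 f g₁)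
    (h₂ : IsWeakDeriv 2 f g₂) : g₁ = g₂ := by
  have h : ((g₁ - g₂ : Lp ℝ 2 μI) : ℝ → ℝ) =ᵐ[μI] 0 := by
    apply ae_zero_of_test (Lp.memLp _)
    intro ψ hψ
    have e : ∫ x, (g₁ - g₂ : Lp ℝ 2 μI) x * ψ x ∂μI
        = ∫ x, (g₁ x * ψ x - g₂ x * ψ x) ∂μI := by
      apply integral_congr_ae
      filter_upwards [Lp.coeFn_sub g₁ g₂] with x hx
      rw [hx, Pi.sub_apply, sub_mul]
    rw [e, integral_sub (integrable_mul_test (Lp.memLp _) hψ)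
      (integrable_mul_test (Lp.memLp _) hψ)]
    have a := h₁ ψ hψ
    have b := h₂ ψ hψ
    norm_num at a b
    linarith
  have := (Lp.eq_zero_iff_ae_eq_zero).2 h
  exact sub_eq_zero.1 this

lemma weakD2_spec {f : ℝ → ℝ} (hf : MemH 2 f) : IsWeakDeriv 2 f (weakD2 f) := by
  have h : ∃ g : Lp ℝ 2 μI, IsWeakDeriv 2 f g := by
    obtain ⟨g, hg, hw⟩ := hf.2 2 le_rfl
    exact ⟨hg.toLp g, hw.congr hg.coeFn_toLp.symm⟩
  rw [weakD2, dif_pos h]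
  exact h.choose_spec

lemma weakD2_add {f g : ℝ → ℝ} (hf : MemH 2 f) (hg : MemH 2 g) (hfg : MemH 2 (f + g)) :
    weakD2 (f + g) = weakD2 f + weakD2 g :=
  weakD2_unique (weakD2_spec hfg)
    ((IsWeakDeriv.add hf.1 hg.1 (Lp.memLp _) (Lp.memLp _) (weakD2_spec hf)
      (weakD2_spec hg)).congr (Lp.coeFn_add _ _).symm)

lemma weakD2_smul {f : ℝ → ℝ} (c : ℝ) (hf : MemH 2 f) (hcf : MemH 2 (c • f)) :
    weakD2 (c • f) = c • weakD2 f :=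
  weakD2_unique (weakD2_spec hcf)
    (((weakD2_spec hf).smul c).congr (Lp.coeFn_smul _ _).symm)

lemma MemH.add {n : ℕ} {f g : ℝ → ℝ} (hf : MemH n f) (hg : MemH n g) : MemH n (f + g) := by
  refine ⟨hf.1.add hg.1, fun k hk => ?_⟩
  obtain ⟨a, ha, ha'⟩ := hf.2 k hk
  obtain ⟨b, hb, hb'⟩ := hg.2 k hk
  exact ⟨a + b, ha.add hb, IsWeakDeriv.add hf.1 hg.1 ha hb ha' hb'⟩

lemma MemH.smul {n : ℕ} {f : ℝ → ℝ} (c : ℝ) (hf : MemH n f) : MemH n (c • f) := by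
  refine ⟨hf.1.const_smul c, fun k hk => ?_⟩
  obtain ⟨a, ha, ha'⟩ := hf.2 k hk
  exact ⟨c • a, ha.const_smul c, ha'.smul c⟩

lemma MemH.zero (n : ℕ) : MemH n 0 :=
  ⟨MemLp.zero, fun k _ => ⟨0, MemLp.zero, fun ψ _ => by simp⟩⟩

/-! ### The Hilbert space `H_0^2([0,1])` -/

/-- The linear space `H_0^2([0,1])`: functions in `H^2([0,1])`, given by their `C^1` representative
on `[0,1]`, which vanish at `0` and `1` together with their first derivative. To have one function
on `ℝ` for each function on `[0,1]`, they are extended by `0`. -/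
def h02Submodule : Submodule ℝ (ℝ → ℝ) where
  carrier := {f | MemH 2 f ∧ ContDiffOn ℝ 1 f (Icc 0 1) ∧ f 0 = 0 ∧ f 1 = 0 ∧
    derivWithin f (Icc 0 1) 0 = 0 ∧ derivWithin f (Icc 0 1) 1 = 0 ∧ ∀ x ∉ Icc (0 : ℝ) 1, f x = 0}
  zero_mem' := by
    refine ⟨MemH.zero 2, contDiffOn_const, rfl, rfl, ?_, ?_, fun _ _ => rfl⟩ <;> simp
  add_mem' := by
    rintro f g ⟨f1, f2, f3, f4, f5, f6, f7⟩ ⟨g1, g2, g3, g4, g5, g6, g7⟩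
    refine ⟨f1.add g1, f2.add g2, by simp [f3, g3], by simp [f4, g4], ?_, ?_,
      fun x hx => by simp [f7 x hx, g7 x hx]⟩
    · rw [derivWithin_add (f2.differentiableOn one_ne_zero 0 (by simp))
        (g2.differentiableOn one_ne_zero 0 (by simp)), f5, g5, add_zero]
    · rw [derivWithin_add (f2.differentiableOn one_ne_zero 1 (by simp))
        (g2.differentiableOn one_ne_zero 1 (by simp)), f6, g6, add_zero]
  smul_mem' := by
    rintro c f ⟨f1, f2, f3, f4, f5, f6, f7⟩
    refine ⟨f1.smul c, f2.const_smul c, by simp [f3], by simp [f4], ?_, ?_,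
      fun x hx => by simp [f7 x hx]⟩
    · have := (((f2.differentiableOn one_ne_zero 0 (by simp)).hasDerivWithinAt).const_smul
        c).derivWithin (uniqueDiffOn_Icc zero_lt_one 0 (by simp))
      rw [this, f5, smul_zero]
    · have := (((f2.differentiableOn one_ne_zero 1 (by simp)).hasDerivWithinAt).const_smul
        c).derivWithin (uniqueDiffOn_Icc zero_lt_one 1 (by simp))
      rw [this, f6, smul_zero]

/-- The space `H_0^2([0,1])`. -/
def H02 : Type := h02Submodule

instance : AddCommGroup H02 := inferInstanceAs (AddCommGroup h02Submodule)

instance : Module ℝ H02 := inferInstanceAs (Module ℝ h02Submodule)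

instance : CoeFun H02 (fun _ => ℝ → ℝ) := ⟨fun f => Subtype.val f⟩

lemma H02.prop (f : H02) : MemH 2 f ∧ ContDiffOn ℝ 1 f (Icc 0 1) ∧ f 0 = 0 ∧ f 1 = 0 ∧
    derivWithin f (Icc 0 1) 0 = 0 ∧ derivWithin f (Icc 0 1) 1 = 0 ∧
    ∀ x ∉ Icc (0 : ℝ) 1, f x = 0 := Subtype.property f

/-- The second derivative `H_0^2([0,1]) → L^2(0,1)`. -/
def H02.d2 : H02 →ₗ[ℝ] Lp ℝ 2 μI where
  toFun f := weakD2 f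
  map_add' f g := weakD2_add f.prop.1 g.prop.1 (f + g).prop.1
  map_smul' c f := weakD2_smul c f.prop.1 (c • f).prop.1

/-- A primitive of a test function with zero mean is a test function. -/
lemma exists_primitive {κ : ℝ → ℝ} (hκ : IsTest κ) (h0 : ∫ x in (0 : ℝ)..1, κ x = 0) :
    ∃ ψ, IsTest ψ ∧ deriv ψ = κ := by
  have hc := hκ.smooth.continuous
  have hd : ∀ x, HasDerivAt (fun x => ∫ y in (0 : ℝ)..x, κ y) (κ x) x := fun x =>
    hc.integral_hasStrictDerivAt 0 x |>.hasDerivAt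
  have hd' : _root_.deriv (fun x => ∫ y in (0 : ℝ)..x, κ y) = κ := funext fun x => (hd x).deriv
  obtain ⟨a, b, ha, hb, hab⟩ : ∃ a b : ℝ, 0 < a ∧ b < 1 ∧ tsupport κ ⊆ Icc a b := by
    have hcomp : IsCompact (tsupport κ) := hκ.compact
    rcases (tsupport κ).eq_empty_or_nonempty with he | hne
    · exact ⟨1, 0, one_pos, zero_lt_one, by simp [he]⟩
    · exact ⟨sInf (tsupport κ), sSup (tsupport κ), (hκ.supp (hcomp.sInf_mem hne)).1,
        (hκ.supp (hcomp.sSup_mem hne)).2,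
        fun x hx => ⟨csInf_le hcomp.bddBelow hx, le_csSup hcomp.bddAbove hx⟩⟩
  have hz : ∀ x ∉ Icc a b, κ x = 0 := fun x hx =>
    image_eq_zero_of_notMem_tsupport fun h => hx (hab h)
  have hs : tsupport (fun x => ∫ y in (0 : ℝ)..x, κ y) ⊆ Icc a b := by
    apply closure_minimal _ isClosed_Icc
    intro x hx
    by_contra hn
    apply hx
    rw [mem_Icc, not_and_or, not_le, not_le] at hn
    rcases hn with hn | hn
    · apply intervalIntegral.integral_zero_ae
      refine Filter.Eventually.of_forall fun y hy => hz y fun h => ?_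
      rw [mem_uIoc] at hy
      rcases hy with hy | hy <;> linarith [h.1, hy.1, hy.2]
    · have e : ∫ y in x..(1 : ℝ), κ y = 0 := by
        apply intervalIntegral.integral_zero_ae
        refine Filter.Eventually.of_forall fun y hy => hz y fun h => ?_
        rw [mem_uIoc] at hy
        rcases hy with hy | hy <;> linarith [h.2, hy.1, hy.2]
      have := intervalIntegral.integral_add_adjacent_intervals
        (hc.intervalIntegrable (μ := volume) 0 x) (hc.intervalIntegrable x 1)
      change ∫ y in (0 : ℝ)..x, κ y = 0
      linarith
  refine ⟨fun x => ∫ y in (0 : ℝ)..x, κ y, ⟨?_, ?_, ?_⟩, hd'⟩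
  · rw [contDiff_infty_iff_deriv]
    exact ⟨fun x => (hd x).differentiableAt, by rw [hd']; exact hκ.smooth⟩
  · exact HasCompactSupport.of_support_subset_isCompact isCompact_Icc
      ((subset_tsupport _).trans hs)
  · exact hs.trans fun x hx => ⟨ha.trans_le hx.1, hx.2.trans_lt hb⟩

lemma exists_bump : ∃ ρ, IsTest ρ ∧ ∫ x in (0 : ℝ)..1, ρ x = 1 := by
  let b : ContDiffBump (1 / 2 : ℝ) := ⟨1 / 8, 1 / 4, by norm_num, by norm_num⟩
  refine ⟨b.normed volume, ⟨b.contDiff_normed, b.hasCompactSupport_normed, ?_⟩, ?_⟩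
  · rw [b.tsupport_normed_eq, Real.closedBall_eq_Icc]
    intro x hx
    norm_num [b] at hx
    constructor <;> linarith [hx.1, hx.2]
  · refine Eq.trans ?_ (b.integral_normed (μ := volume))
    rw [intervalIntegral.integral_of_le zero_le_one]
    apply setIntegral_eq_integral_of_forall_compl_eq_zero
    intro x hx
    apply image_eq_zero_of_notMem_tsupport
    rw [b.tsupport_normed_eq, Real.closedBall_eq_Icc]
    intro h
    norm_num [b] at h
    exact hx ⟨by linarith [h.1], by linarith [h.2]⟩

lemma integral_μI (f : ℝ → ℝ) : ∫ x, f x ∂μI = ∫ x in (0 : ℝ)..1, f x := by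
  rw [intervalIntegral.integral_of_le zero_le_one, integral_Ioc_eq_integral_Ioo]

lemma H02.d2_injective : Function.Injective H02.d2 := by
  rw [injective_iff_map_eq_zero]
  intro f hf
  obtain ⟨f1, f2, f3, f4, f5, f6, f7⟩ := f.prop
  set h : ℝ → ℝ := derivWithin f (Icc 0 1) with hh
  have hcont : ContinuousOn h (Icc 0 1) :=
    f2.continuousOn_derivWithin (uniqueDiffOn_Icc zero_lt_one) le_rfl
  have hder : ∀ x ∈ Ioo (0 : ℝ) 1, HasDerivAt f (h x) x := fun x hx =>
    ((f2.differentiableOn one_ne_zero x (Ioo_subset_Icc_self hx)).hasDerivWithinAt).hasDerivAt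
      (Icc_mem_nhds hx.1 hx.2)
  have hint : IntervalIntegrable h volume 0 1 :=
    ContinuousOn.intervalIntegrable (by rwa [uIcc_of_le zero_le_one])
  have hw : IsWeakDeriv 2 f (weakD2 f) := weakD2_spec f1
  have hf' : weakD2 f = 0 := hf
  have step1 : ∀ ψ, IsTest ψ → ∫ x in (0 : ℝ)..1, h x * deriv ψ x = 0 := by
    intro ψ hψ
    have a := hw ψ hψ
    rw [hf'] at a
    have z : ∫ x, (0 : Lp ℝ 2 μI) x * ψ x ∂μI = 0 := by
      rw [← integral_zero ℝ ℝ (μ := μI)]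
      apply integral_congr_ae
      filter_upwards [Lp.coeFn_zero ℝ 2 μI] with x hx
      rw [hx]; simp
    rw [z, mul_zero, integral_μI] at a
    have e := intervalIntegral.integral_mul_deriv_eq_deriv_mul_of_hasDerivAt
      (a := 0) (b := 1) (u := f) (u' := h) (v := deriv ψ) (v' := iteratedDeriv 2 ψ)
      (by rw [uIcc_of_le zero_le_one]; exact f2.continuousOn)
      (hψ.deriv.smooth.continuous.continuousOn)
      (by rw [min_eq_left zero_le_one, max_eq_right zero_le_one]; exact hder)
      (by
        intro x _
        rw [iteratedDeriv_succ, iteratedDeriv_one]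
        exact (hψ.deriv.smooth.differentiable (by simp) x).hasDerivAt)
      hint ((hψ.iteratedDeriv 2).smooth.continuous.intervalIntegrable _ _)
    rw [a, f3, f4] at e
    linarith
  obtain ⟨ρ, hρ, hρ1⟩ := exists_bump
  set c := ∫ x in (0 : ℝ)..1, h x * ρ x with hc
  have hmem : MemLp h 2 μI := by
    obtain ⟨C, hC⟩ := isCompact_Icc.exists_bound_of_continuousOn hcont
    refine MemLp.of_bound ((hcont.mono Ioo_subset_Icc_self).aestronglyMeasurable
      measurableSet_Ioo) C ?_
    exact (ae_restrict_iff' measurableSet_Ioo).2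
      (Filter.Eventually.of_forall fun x hx => hC x (Ioo_subset_Icc_self hx))
  have hae : (fun x => h x - c) =ᵐ[μI] 0 := by
    apply ae_zero_of_test (hmem.sub (memLp_const c))
    intro χ hχ
    have hci : ∀ {θ : ℝ → ℝ}, Continuous θ → IntervalIntegrable (fun x => h x * θ x) volume 0 1 :=
      fun hθ => hint.mul_continuousOn hθ.continuousOn
    have hcθ : Continuous χ := hχ.smooth.continuous
    have hcρ : Continuous ρ := hρ.smooth.continuous
    set m := ∫ x in (0 : ℝ)..1, χ x with hm
    have hκ : IsTest (fun x => χ x - m * ρ x) := by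
      refine ⟨hχ.smooth.sub (contDiff_const.mul hρ.smooth),
        hχ.compact.sub hρ.compact.mul_left, ?_⟩
      refine (tsupport_sub _ _).trans (union_subset hχ.supp ?_)
      exact (tsupport_mul_subset_right).trans hρ.supp
    obtain ⟨ψ, hψ, hψ'⟩ := exists_primitive hκ (by
      rw [intervalIntegral.integral_sub (hcθ.intervalIntegrable _ _)
        ((hcρ.intervalIntegrable _ _).const_mul m),
        intervalIntegral.integral_const_mul, hρ1, ← hm]
      ring)
    have s := step1 ψ hψ
    rw [hψ'] at s
    have e1 : ∫ x in (0 : ℝ)..1, h x * (χ x - m * ρ x)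
        = (∫ x in (0 : ℝ)..1, h x * χ x) - m * c := by
      rw [hc, ← intervalIntegral.integral_const_mul, ← intervalIntegral.integral_sub (hci hcθ)
        ((hci hcρ).const_mul m)]
      congr 1
      funext x
      ring
    have e2 : ∫ x in (0 : ℝ)..1, (h x - c) * χ x
        = (∫ x in (0 : ℝ)..1, h x * χ x) - c * m := by
      rw [hm, ← intervalIntegral.integral_const_mul, ← intervalIntegral.integral_sub (hci hcθ)
        ((hcθ.intervalIntegrable _ _).const_mul c)]
      congr 1
      funext x
      ring
    rw [integral_μI]
    change ∫ x in (0 : ℝ)..1, (h x - c) * χ x = 0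
    rw [e2]
    rw [e1] at s
    linarith
  have hall : EqOn h (fun _ => c) (Icc 0 1) := by
    have : EqOn h (fun _ => c) (Ioo 0 1) := by
      refine Measure.eqOn_open_of_ae_eq (μ := volume) ?_ isOpen_Ioo
        (hcont.mono Ioo_subset_Icc_self) continuousOn_const
      filter_upwards [hae] with x hx
      simpa [sub_eq_zero] using hx
    exact this.of_subset_closure hcont continuousOn_const Ioo_subset_Icc_self
      (by rw [closure_Ioo zero_ne_one])
  have hc0 : c = 0 := (hall (left_mem_Icc.2 zero_le_one)).symm.trans f5
  have hconst : ∀ x ∈ Icc (0 : ℝ) 1, f x = f 0 :=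
    constant_of_derivWithin_zero (f2.differentiableOn one_ne_zero) fun x hx => by
      rw [← hh, hall (Ico_subset_Icc_self hx), hc0]
  apply Subtype.ext
  funext x
  by_cases hx : x ∈ Icc (0 : ℝ) 1
  · exact (hconst x hx).trans f3
  · exact f7 x hx

/-- `H_0^2([0,1])` with the norm `‖f‖ = (∫₀¹ (∂ₓₓ f)² dx)^{1/2}`. -/
instance : NormedAddCommGroup H02 :=
  NormedAddCommGroup.induced H02 (Lp ℝ 2 μI) H02.d2 H02.d2_injective

instance : NormedSpace ℝ H02 := NormedSpace.induced ℝ H02 (Lp ℝ 2 μI) H02.d2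

/-! ### The diffeomorphism group, its right-invariant metric and its geodesics -/

/-- The map `Id + f`. -/
def toMap (f : H02) : ℝ → ℝ := fun x => x + f x

/-- `Diff_0^2([0,1]) = {Id + f | f ∈ H_0^2([0,1]), 1 + f' > 0}`; the diffeomorphism `Id + f` is
encoded by `f`, so that the group is an open subset of the Hilbert space `H_0^2([0,1])` and its
tangent spaces are all equal to `H_0^2([0,1])`. -/
def Diff02 : Set H02 := {f | ∀ x ∈ Icc (0 : ℝ) 1, 0 < 1 + derivWithin f (Icc 0 1) x}

/-- The inverse on `[0,1]` of the diffeomorphism `φ = Id + f`. -/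
def invMap (f : H02) : ℝ → ℝ := Function.invFunOn (toMap f) (Icc 0 1)

/-- The right-invariant metric `G_φ(X, Y) = ⟨X ∘ φ⁻¹, Y ∘ φ⁻¹⟩_{H_0^2}` at `φ = Id + f`. -/
def metricG (f X Y : H02) : ℝ := innerH02 (X ∘ invMap f) (Y ∘ invMap f)

/-- The velocity at time `t` of a curve on the time interval `[0,1]`. -/
def velocity (γ : ℝ → H02) (t : ℝ) : H02 := derivWithin γ (Icc 0 1) t

/-- The energy `½ ∫₀¹ G_{γ(t)}(γ'(t), γ'(t)) dt`. -/
def energy (γ : ℝ → H02) : ℝ :=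
  (1 / 2) * ∫ t in (0 : ℝ)..1, metricG (γ t) (velocity γ t) (velocity γ t)

/-- A geodesic `γ : [0,1] → Diff_0^2([0,1])` of the metric `G`: a `C^1` curve which is a critical
point of the energy with respect to smooth variations with fixed endpoints. For small `s` the
curve `γ + s • h` stays in the open set `Diff_0^2([0,1])`. -/
structure IsGeodesic (γ : ℝ → H02) : Prop where
  mem : ∀ t ∈ Icc (0 : ℝ) 1, γ t ∈ Diff02
  contDiff : ContDiffOn ℝ 1 γ (Icc 0 1)
  critical : ∀ h : ℝ → H02, ContDiff ℝ ∞ h → h 0 = 0 → h 1 = 0 →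
    HasDerivAt (fun s : ℝ => energy (fun t => γ t + s • h t)) 0 0

end

end SobolevDiff

/-! # Regularity of geodesics of the right-invariant second order metric on the interval -/

open MeasureTheory Set
open scoped ContDiff

namespace SobolevDiff

noncomputable section

/-! Write φ(t) for the geodesic, u = φ_t ∘ φ⁻¹ for its Eulerian velocity, F = φ_xx and X = φ_txx.
The map `D` identifies H_0^2 isometrically with a subspace of L², and everything is expressed in
Lagrangian coordinates: φ_x = `E F`, u_x ∘ φ = `V X * R F`, u_xx ∘ φ = `wf F X`, and `zf F X` =
∂_x(u_x ∘ φ) = φ_x · (u_xx ∘ φ). The energy density is the integral of φ_x (u_xx ∘ φ)²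
(`metricG_self`), which is smooth in (F, X) although composition with φ⁻¹ is not.

The Euler-Lagrange equation makes the momentum differentiable in time as a functional on H_0^2.
Testing it with fields that move with the flow, namely those with x-derivative φ_x · `V κ`, cancels
the terms that cost regularity; the rest are integrated by parts onto κ (`IsGeodesic.inner_wf_eq`).
Hence u_xx ∘ φ(t) = u_xx(0) + T(t) with T(t) continuous in x (`IsGeodesic.exists_wf_eq`): the rough
part of u_xx ∘ φ is transported unchanged.

Integrating ∂_t(φ_xx / φ_x) = φ_x · (u_xx ∘ φ) from the identity gives, at time 1, p = β X(0) + α,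
where p = φ_1'' / φ_1', β = ∫ φ_x dt > 0 and α = ∫ φ_x T dt. So X(0) = (p - α) / β, and X(0) is as
regular as p once φ_x and T are regular in x.

That regularity comes from exchanging the variables. As functions of x with values in C([0,1]) of
time, φ_x, u_x ∘ φ and T solve an ordinary differential equation driven by X(0)
(`IsGeodesic.exists_ode`). If they are C^j and p is C^j, then X(0) is C^j by the formula above, and
the equation makes them C^{j+1} (`contDiffOn_of_ode`). The induction stops one order above the
classical regularity of p, and a last use of the formula gives X(0) the Sobolev regularity of p. -/

/-- The Hilbert space `L^2(0,1)`. -/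
abbrev L2 : Type := Lp ℝ 2 μI

/-- The Banach algebra of continuous functions on `[0,1]`. -/
abbrev CI : Type := C(Icc (0 : ℝ) 1, ℝ)

/-! ### L² as a module over the continuous functions -/

/-- The extension of a continuous function on `[0,1]` to `ℝ` which is constant outside `[0,1]`. -/
def ext (c : CI) : ℝ → ℝ := IccExtend zero_le_one c

lemma ext_continuous (c : CI) : Continuous (ext c) := c.continuous.Icc_extend'

lemma ext_of_mem (c : CI) {x : ℝ} (hx : x ∈ Icc (0 : ℝ) 1) : ext c x = c ⟨x, hx⟩ :=
  IccExtend_of_mem _ _ hx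

lemma abs_ext_le (c : CI) (x : ℝ) : |ext c x| ≤ ‖c‖ := c.norm_coe_le_norm _

lemma intervalIntegrable_of_μI {f : ℝ → ℝ} (h : Integrable f μI) :
    IntervalIntegrable f volume 0 1 := by
  rw [intervalIntegrable_iff_integrableOn_Ioo_of_le zero_le_one]
  exact h

lemma intervalIntegrable_of_μI' {f : ℝ → ℝ} (h : Integrable f μI) {x : ℝ}
    (hx : x ∈ Icc (0 : ℝ) 1) : IntervalIntegrable f volume 0 x :=
  (intervalIntegrable_of_μI h).mono_set (by
    rw [uIcc_of_le zero_le_one, uIcc_of_le hx.1]; exact Icc_subset_Icc_right hx.2)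

lemma L2.integrable_mul (u v : L2) : Integrable (fun x => u x * v x) μI :=
  (Lp.memLp u).integrable_mul (Lp.memLp v)

lemma L2.integrable (u : L2) : Integrable u μI :=
  (Lp.memLp u).integrable (by norm_num)

lemma ext_mul_memLp (c : CI) (u : L2) : MemLp (fun x => ext c x * u x) 2 μI := by
  refine (Lp.memLp u).of_le_mul (c := ‖c‖)
    ((ext_continuous c).aestronglyMeasurable.mul (Lp.aestronglyMeasurable u)) ?_
  refine Filter.Eventually.of_forall fun x => ?_
  rw [norm_mul]
  exact mul_le_mul_of_nonneg_right (abs_ext_le c x) (norm_nonneg _)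

instance : SMul CI L2 := ⟨fun c u => (ext_mul_memLp c u).toLp _⟩

lemma coeFn_smulCI (c : CI) (u : L2) : (c • u : L2) =ᵐ[μI] fun x => ext c x * u x :=
  (ext_mul_memLp c u).coeFn_toLp

/-- Treating pointwise multiplication as a bounded scalar action makes the product rules, continuity
lemmas and the tactic `module` available for all nonlinear expressions below. -/
instance : Module CI L2 where
  one_smul u := by
    apply Lp.ext
    filter_upwards [coeFn_smulCI 1 u] with x hx
    rw [hx]
    exact one_mul _
  mul_smul c d u := by
    apply Lp.ext
    filter_upwards [coeFn_smulCI (c * d) u, coeFn_smulCI c (d • u), coeFn_smulCI d u] with x h h' h''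
    rw [h, h', h'']
    exact mul_assoc _ _ _
  smul_zero c := by
    apply Lp.ext
    filter_upwards [coeFn_smulCI c 0, Lp.coeFn_zero ℝ 2 μI] with x h h'
    rw [h, h']
    exact mul_zero _
  smul_add c u v := by
    apply Lp.ext
    filter_upwards [coeFn_smulCI c (u + v), coeFn_smulCI c u, coeFn_smulCI c v,
      Lp.coeFn_add u v, Lp.coeFn_add (c • u) (c • v)] with x h1 h2 h3 h4 h5
    rw [h1, h5, Pi.add_apply, h2, h3, h4, Pi.add_apply, mul_add]
  add_smul c d u := by
    apply Lp.ext
    filter_upwards [coeFn_smulCI (c + d) u, coeFn_smulCI c u, coeFn_smulCI d u,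
      Lp.coeFn_add (c • u) (d • u)] with x h1 h2 h3 h5
    rw [h1, h5, Pi.add_apply, h2, h3, ← add_mul]
    rfl
  zero_smul u := by
    apply Lp.ext
    filter_upwards [coeFn_smulCI 0 u, Lp.coeFn_zero ℝ 2 μI] with x h h'
    rw [h, h']
    exact zero_mul _

lemma norm_smulCI_le (c : CI) (u : L2) : ‖c • u‖ ≤ ‖c‖ * ‖u‖ := by
  apply Lp.norm_le_mul_norm_of_ae_le_mul
  filter_upwards [coeFn_smulCI c u] with x hx
  rw [hx, norm_mul]
  exact mul_le_mul_of_nonneg_right (abs_ext_le c x) (norm_nonneg _)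

instance : IsBoundedSMul CI L2 := IsBoundedSMul.of_norm_smul_le norm_smulCI_le

instance : IsScalarTower ℝ CI L2 where
  smul_assoc r c u := by
    apply Lp.ext
    filter_upwards [coeFn_smulCI (r • c) u, coeFn_smulCI c u, Lp.coeFn_smul r (c • u)] with x h h' h''
    rw [h, h'', Pi.smul_apply, h', smul_eq_mul, ← mul_assoc]
    rfl

instance : SMulCommClass ℝ CI L2 := IsScalarTower.to_smulCommClass

/-! ### Primitives and integration by parts -/

/-- The primitive vanishing at `0` of the product of two functions in `L^2(0,1)`. -/
def primMul (u v : L2) : CI where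
  toFun y := ∫ x in (0 : ℝ)..y, u x * v x
  continuous_toFun := by
    have h := intervalIntegral.continuousOn_primitive_interval (μ := volume)
      (f := fun x => u x * v x) (a := 0) (b := 1) (by
        have := (intervalIntegrable_iff_integrableOn_Icc_of_le zero_le_one).1
          (intervalIntegrable_of_μI (u.integrable_mul v))
        rwa [uIcc_of_le zero_le_one])
    rw [uIcc_of_le zero_le_one] at h
    exact continuousOn_iff_continuous_domRestrict.1 h

lemma primMul_apply (u v : L2) (y : Icc (0 : ℝ) 1) :
    primMul u v y = ∫ x in (0 : ℝ)..y, u x * v x := rfl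

lemma integral_congr_μI {f g : ℝ → ℝ} (h : f =ᵐ[μI] g) {y : ℝ} (hy : y ∈ Icc (0 : ℝ) 1) :
    ∫ x in (0 : ℝ)..y, f x = ∫ x in (0 : ℝ)..y, g x := by
  rw [intervalIntegral.integral_of_le hy.1, intervalIntegral.integral_of_le hy.1,
    integral_Ioc_eq_integral_Ioo, integral_Ioc_eq_integral_Ioo]
  exact integral_congr_ae (ae_restrict_of_ae_restrict_of_subset (Ioo_subset_Ioo_right hy.2) h)

lemma norm_primMul_le (u v : L2) : ‖primMul u v‖ ≤ 1 * ‖u‖ * ‖v‖ := by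
  rw [one_mul, ContinuousMap.norm_le _ (by positivity)]
  intro y
  rw [primMul_apply, intervalIntegral.integral_of_le y.2.1]
  have hi : Integrable (fun x => |u x| * |v x|) μI := by
    simpa only [abs_mul] using (u.integrable_mul v).abs
  calc ‖∫ x in Ioc (0 : ℝ) y, u x * v x‖ ≤ ∫ x in Ioc (0 : ℝ) y, ‖u x * v x‖ :=
        norm_integral_le_integral_norm _
    _ = ∫ x in Ioo (0 : ℝ) y, |u x| * |v x| := by
        rw [integral_Ioc_eq_integral_Ioo]; simp only [Real.norm_eq_abs, abs_mul]
    _ ≤ ∫ x in Ioo (0 : ℝ) 1, |u x| * |v x| :=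
        setIntegral_mono_set hi (Filter.Eventually.of_forall fun x => by positivity)
          (Ioo_subset_Ioo_right y.2.2).eventuallyLE
    _ = inner ℝ |u| |v| := by
        rw [L2.inner_def]
        apply integral_congr_ae
        filter_upwards [Lp.coeFn_abs u, Lp.coeFn_abs v] with x h h'
        rw [h, h']
        simp [mul_comm]
    _ ≤ ‖|u|‖ * ‖|v|‖ := real_inner_le_norm _ _
    _ = ‖u‖ * ‖v‖ := by rw [norm_abs_eq_norm, norm_abs_eq_norm]

lemma primMul_comm (u v : L2) : primMul u v = primMul v u := by
  ext y
  simp only [primMul_apply, mul_comm]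

lemma primMul_add_right (u v w : L2) : primMul u (v + w) = primMul u v + primMul u w := by
  ext y
  simp only [primMul_apply, ContinuousMap.add_apply]
  rw [← intervalIntegral.integral_add (intervalIntegrable_of_μI' (u.integrable_mul v) y.2)
    (intervalIntegrable_of_μI' (u.integrable_mul w) y.2)]
  apply integral_congr_μI _ y.2
  filter_upwards [Lp.coeFn_add v w] with x h
  rw [h, Pi.add_apply, mul_add]

lemma primMul_smul_right (c : ℝ) (u v : L2) : primMul u (c • v) = c • primMul u v := by
  ext y
  simp only [primMul_apply, ContinuousMap.smul_apply, smul_eq_mul]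
  rw [← intervalIntegral.integral_const_mul]
  apply integral_congr_μI _ y.2
  filter_upwards [Lp.coeFn_smul c v] with x h
  rw [h, Pi.smul_apply, smul_eq_mul]
  ring

/-- The continuous bilinear map which sends `(u, v)` to the primitive of `u * v`. -/
def B : L2 →L[ℝ] L2 →L[ℝ] CI :=
  LinearMap.mkContinuous₂ (LinearMap.mk₂ ℝ primMul
    (fun u v w => by rw [primMul_comm, primMul_add_right, primMul_comm w, primMul_comm w])
    (fun c u v => by rw [primMul_comm, primMul_smul_right, primMul_comm])
    primMul_add_right primMul_smul_right) 1 norm_primMul_le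

lemma B_apply (u v : L2) (y : Icc (0 : ℝ) 1) : B u v y = ∫ x in (0 : ℝ)..y, u x * v x := rfl

lemma B_smul_comm (c : CI) (u v : L2) : B (c • u) v = B u (c • v) := by
  ext y
  rw [B_apply, B_apply]
  apply integral_congr_μI _ y.2
  filter_upwards [coeFn_smulCI c u, coeFn_smulCI c v] with x h h'
  rw [h, h']
  ring

/-- The constant function `1` in `L^2(0,1)`. -/
def one : L2 := (memLp_const (1 : ℝ)).toLp _

lemma coeFn_one : one =ᵐ[μI] fun _ => 1 := MemLp.coeFn_toLp _

/-- The primitive vanishing at `0` of a function in `L^2(0,1)`. -/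
def V : L2 →L[ℝ] CI := B one

lemma V_apply (u : L2) (y : Icc (0 : ℝ) 1) : V u y = ∫ x in (0 : ℝ)..y, u x := by
  rw [V, B_apply]
  apply integral_congr_μI _ y.2
  filter_upwards [coeFn_one] with x h
  rw [h, one_mul]

lemma ext_V (u : L2) {x : ℝ} (hx : x ∈ Icc (0 : ℝ) 1) : ext (V u) x = ∫ y in (0 : ℝ)..x, u y := by
  rw [ext_of_mem _ hx, V_apply]

/-- The inclusion of continuous functions into `L^2(0,1)`. -/
def ι : CI →L[ℝ] L2 := (ContinuousLinearMap.lsmul ℝ CI).flip one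

lemma ι_apply (c : CI) : ι c = c • one := rfl

lemma coeFn_ι (c : CI) : ι c =ᵐ[μI] ext c := by
  filter_upwards [coeFn_smulCI c one, coeFn_one] with x h h'
  rw [ι_apply, h, h', mul_one]

lemma V_smul_eq_B (c : CI) (u : L2) : V (c • u) = B (ι c) u := by
  rw [V, ι_apply, B_smul_comm]

/-- Primitives of integrable functions are absolutely continuous, and their derivative is the
integrand almost everywhere. The Leibniz rule for `B` and the weak integrations by parts against
primitives rest on this. -/
lemma mul_primitive_eq {f g : ℝ → ℝ} (hf : Integrable f μI) (hg : Integrable g μI) {x : ℝ}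
    (hx : x ∈ Icc (0 : ℝ) 1) :
    (∫ y in (0 : ℝ)..x, f y) * (∫ y in (0 : ℝ)..x, g y) =
      ∫ y in (0 : ℝ)..x, (f y * (∫ s in (0 : ℝ)..y, g s) + (∫ s in (0 : ℝ)..y, f s) * g y) := by
  have hf' := intervalIntegrable_of_μI' hf hx
  have hg' := intervalIntegrable_of_μI' hg hx
  have a := hf'.absolutelyContinuousOnInterval_intervalIntegral (c := 0) (by simp)
  have b := hg'.absolutelyContinuousOnInterval_intervalIntegral (c := 0) (by simp)
  have e := AbsolutelyContinuousOnInterval.integral_deriv_mul_eq_sub a b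
  simp only [intervalIntegral.integral_same, mul_zero, sub_zero] at e
  rw [← e]
  apply intervalIntegral.integral_congr_ae
  filter_upwards [hf'.ae_hasDerivAt_integral, hg'.ae_hasDerivAt_integral] with y h h' hy
  have hy' := uIoc_subset_uIcc hy
  rw [(h hy' 0 (by simp)).deriv, (h' hy' 0 (by simp)).deriv]

lemma integrable_ext_mul (c : CI) {f : ℝ → ℝ} (hf : Integrable f μI) :
    Integrable (fun x => ext c x * f x) μI :=
  hf.bdd_mul (c := ‖c‖) (ext_continuous c).aestronglyMeasurable
    (Filter.Eventually.of_forall (abs_ext_le c))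

/-- Leibniz' rule for a product of primitives. -/
lemma B_mul_V (u v k : L2) : B u v * V k = B u (V k • v) + V (B u v • k) := by
  ext x
  have hi := u.integrable_mul v
  have e := mul_primitive_eq hi k.integrable x.2
  rw [ContinuousMap.mul_apply, B_apply, V_apply, e, ContinuousMap.add_apply, B_apply, V_apply,
    ← intervalIntegral.integral_add (intervalIntegrable_of_μI' (u.integrable_mul _) x.2)
    (intervalIntegrable_of_μI' (L2.integrable _) x.2)]
  apply integral_congr_μI _ x.2
  filter_upwards [coeFn_smulCI (V k) v, coeFn_smulCI (B u v) k,
    ae_restrict_mem measurableSet_Ioo] with y h h' hy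
  rw [h, h', ext_V _ (Ioo_subset_Icc_self hy), ext_of_mem _ (Ioo_subset_Icc_self hy), B_apply]
  ring

lemma V_mul_V (u v : L2) : V u * V v = V (V v • u) + V (V u • v) := B_mul_V one u v


/-! ### Weak derivatives in dimension one -/

lemma IsTest.endpoints_eq_zero {ψ : ℝ → ℝ} (h : IsTest ψ) : ψ 0 = 0 ∧ ψ 1 = 0 :=
  ⟨image_eq_zero_of_notMem_tsupport fun h0 => lt_irrefl _ (h.supp h0).1,
    image_eq_zero_of_notMem_tsupport fun h0 => lt_irrefl _ (h.supp h0).2⟩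

/-- The fundamental lemma of du Bois-Reymond. -/
lemma ae_const_of_test_deriv {h : ℝ → ℝ} (hmem : MemLp h 2 μI)
    (hh : ∀ ψ, IsTest ψ → ∫ x, h x * deriv ψ x ∂μI = 0) : ∃ c : ℝ, h =ᵐ[μI] fun _ => c := by
  obtain ⟨ρ, hρ, hρ1⟩ := exists_bump
  rw [← integral_μI] at hρ1
  set c := ∫ x, h x * ρ x ∂μI with hc
  refine ⟨c, ?_⟩
  have hae : (fun x => h x - c) =ᵐ[μI] 0 := by
    apply ae_zero_of_test (hmem.sub (memLp_const c))
    intro χ hχ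
    have hi : ∀ {θ : ℝ → ℝ}, IsTest θ → Integrable θ μI :=
      fun hθ => hθ.memLp.integrable (by norm_num)
    set m := ∫ x, χ x ∂μI with hm
    have hκ : IsTest (fun x => χ x - m * ρ x) := by
      refine ⟨hχ.smooth.sub (contDiff_const.mul hρ.smooth),
        hχ.compact.sub hρ.compact.mul_left, ?_⟩
      refine (tsupport_sub _ _).trans (union_subset hχ.supp ?_)
      exact (tsupport_mul_subset_right).trans hρ.supp
    obtain ⟨ψ, hψ, hψ'⟩ := exists_primitive hκ (by
      rw [← integral_μI, integral_sub (hi hχ) ((hi hρ).const_mul m),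
        integral_const_mul, hρ1, ← hm]
      ring)
    have s := hh ψ hψ
    rw [hψ'] at s
    have e1 : ∫ x, h x * (χ x - m * ρ x) ∂μI = (∫ x, h x * χ x ∂μI) - m * c := by
      rw [hc, ← integral_const_mul, ← integral_sub (integrable_mul_test hmem hχ)
        ((integrable_mul_test hmem hρ).const_mul m)]
      congr 1
      funext x
      ring
    have e2 : ∫ x, (h x - c) * χ x ∂μI = (∫ x, h x * χ x ∂μI) - c * m := by
      rw [hm, ← integral_const_mul, ← integral_sub (integrable_mul_test hmem hχ)
        ((hi hχ).const_mul c)]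
      congr 1
      funext x
      ring
    change ∫ x, (h x - c) * χ x ∂μI = 0
    rw [e2]
    rw [e1] at s
    linarith
  filter_upwards [hae] with x hx
  simpa [sub_eq_zero] using hx

lemma IsWeakDeriv.congr_left {k : ℕ} {f f' g : ℝ → ℝ} (h : IsWeakDeriv k f g) (hf : f =ᵐ[μI] f') :
    IsWeakDeriv k f' g := by
  intro ψ hψ
  rw [← h ψ hψ]
  apply integral_congr_ae
  filter_upwards [hf] with x hx
  rw [hx]

/-- Composition of weak derivatives. -/
lemma IsWeakDeriv.succ {k : ℕ} {f g h : ℝ → ℝ} (h1 : IsWeakDeriv 1 f g) (h2 : IsWeakDeriv k g h) :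
    IsWeakDeriv (k + 1) f h := by
  intro ψ hψ
  have a := h1 _ (hψ.iteratedDeriv k)
  have b := h2 ψ hψ
  rw [iteratedDeriv_one] at a
  rw [iteratedDeriv_succ, a, b]
  ring

/-- The k-th derivative of a test function is again a test function, so the first-order relation may
be tested with it; this peels one derivative off a higher-order relation. -/
lemma IsWeakDeriv.of_succ {k : ℕ} {f g h : ℝ → ℝ} (h1 : IsWeakDeriv 1 f g)
    (h2 : IsWeakDeriv (k + 1) f h) : IsWeakDeriv k g h := by
  intro ψ hψ
  have a := h1 _ (hψ.iteratedDeriv k)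
  have b := h2 ψ hψ
  rw [iteratedDeriv_one] at a
  rw [iteratedDeriv_succ, a, pow_one, pow_succ] at b
  linarith

lemma isWeakDeriv_zero (f : ℝ → ℝ) : IsWeakDeriv 0 f f := by
  intro ψ _
  simp

lemma IsWeakDeriv.sub {k : ℕ} {f₁ f₂ g₁ g₂ : ℝ → ℝ} (hf₁ : MemLp f₁ 2 μI) (hf₂ : MemLp f₂ 2 μI)
    (hg₁ : MemLp g₁ 2 μI) (hg₂ : MemLp g₂ 2 μI) (h₁ : IsWeakDeriv k f₁ g₁)
    (h₂ : IsWeakDeriv k f₂ g₂) : IsWeakDeriv k (f₁ - f₂) (g₁ - g₂) := by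
  have := IsWeakDeriv.add hf₁ (hf₂.const_smul (-1 : ℝ)) hg₁ (hg₂.const_smul (-1 : ℝ)) h₁
    (h₂.smul (-1))
  simpa [sub_eq_add_neg] using this

lemma isWeakDeriv_const (c : ℝ) : IsWeakDeriv 1 (fun _ => c) 0 := by
  intro ψ hψ
  have : ∫ x in (0 : ℝ)..1, deriv ψ x = ψ 1 - ψ 0 :=
    intervalIntegral.integral_deriv_eq_sub
      (fun x _ => hψ.smooth.differentiable (by simp) x)
      (hψ.deriv.smooth.continuous.intervalIntegrable _ _)
  rw [hψ.endpoints_eq_zero.1, hψ.endpoints_eq_zero.2] at this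
  rw [iteratedDeriv_one, integral_const_mul, integral_μI, this]
  simp

lemma isWeakDeriv_V (u : L2) : IsWeakDeriv 1 (ext (V u)) u := by
  intro ψ hψ
  have hd : ∀ x, ∫ y in (0 : ℝ)..x, deriv ψ y = ψ x := by
    intro x
    rw [intervalIntegral.integral_deriv_eq_sub (fun x _ => hψ.smooth.differentiable (by simp) x)
      (hψ.deriv.smooth.continuous.intervalIntegrable _ _), hψ.endpoints_eq_zero.1, sub_zero]
  have e := mul_primitive_eq u.integrable (hψ.deriv.memLp.integrable (by norm_num))
    (right_mem_Icc.2 zero_le_one)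
  simp only [hd, hψ.endpoints_eq_zero.2, mul_zero] at e
  rw [← integral_μI] at e
  have e2 : ∫ y, u y * ψ y + (∫ s in (0 : ℝ)..y, u s) * deriv ψ y ∂μI =
      ∫ y, u y * ψ y + ext (V u) y * deriv ψ y ∂μI := by
    apply integral_congr_ae
    filter_upwards [ae_restrict_mem measurableSet_Ioo] with y hy
    rw [ext_V _ (Ioo_subset_Icc_self hy)]
  rw [e2, integral_add (integrable_mul_test (Lp.memLp u) hψ)
    (integrable_ext_mul _ (hψ.deriv.memLp.integrable (by norm_num)))] at e
  rw [iteratedDeriv_one, pow_one]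
  linarith

lemma memLp_of_continuousOn {h : ℝ → ℝ} (hcont : ContinuousOn h (Icc 0 1)) : MemLp h 2 μI := by
  obtain ⟨C, hC⟩ := isCompact_Icc.exists_bound_of_continuousOn hcont
  refine MemLp.of_bound ((hcont.mono Ioo_subset_Icc_self).aestronglyMeasurable
    measurableSet_Ioo) C ?_
  exact (ae_restrict_iff' measurableSet_Ioo).2
    (Filter.Eventually.of_forall fun x hx => hC x (Ioo_subset_Icc_self hx))

lemma memLp_ext (c : CI) : MemLp (ext c) 2 μI := memLp_of_continuousOn (ext_continuous c).continuousOn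

/-- The difference from the primitive has weak derivative zero, so du Bois-Reymond makes it
constant. -/
lemma IsWeakDeriv.eq_const_add {f : ℝ → ℝ} {g : L2} (hf : MemLp f 2 μI) (h : IsWeakDeriv 1 f g) :
    ∃ c : ℝ, f =ᵐ[μI] fun x => c + ext (V g) x := by
  have hs := IsWeakDeriv.sub hf (memLp_ext _) (Lp.memLp g) (Lp.memLp g) h (isWeakDeriv_V g)
  obtain ⟨c, hc⟩ := ae_const_of_test_deriv (hf.sub (memLp_ext (V g))) (fun ψ hψ => by
    have := hs ψ hψ
    rw [iteratedDeriv_one] at this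
    simpa using this)
  refine ⟨c, ?_⟩
  filter_upwards [hc] with x hx
  rw [Pi.sub_apply] at hx
  linarith

lemma eqOn_Icc_of_ae_eq {f g : ℝ → ℝ} (hf : ContinuousOn f (Icc 0 1)) (hg : ContinuousOn g (Icc 0 1))
    (h : f =ᵐ[μI] g) : EqOn f g (Icc 0 1) := by
  have : EqOn f g (Ioo 0 1) :=
    Measure.eqOn_open_of_ae_eq h isOpen_Ioo
      (hf.mono Ioo_subset_Icc_self) (hg.mono Ioo_subset_Icc_self)
  exact this.of_subset_closure hf hg Ioo_subset_Icc_self (by rw [closure_Ioo zero_ne_one])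

/-! ### H_0^2 seen through the second derivative -/

/-- The second derivative as an isometric embedding of `H_0^2([0,1])` into `L^2(0,1)`. -/
def D : H02 →ₗᵢ[ℝ] L2 := ⟨H02.d2, fun _ => rfl⟩

lemma H02.contDiffOn (f : H02) : ContDiffOn ℝ 1 f (Icc 0 1) := f.prop.2.1

lemma H02.hasDerivWithinAt (f : H02) {x : ℝ} (hx : x ∈ Icc (0 : ℝ) 1) :
    HasDerivWithinAt f (derivWithin f (Icc 0 1) x) (Icc 0 1) x :=
  (f.contDiffOn.differentiableOn one_ne_zero x hx).hasDerivWithinAt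

lemma H02.continuousOn_derivWithin (f : H02) : ContinuousOn (derivWithin f (Icc 0 1)) (Icc 0 1) :=
  f.contDiffOn.continuousOn_derivWithin (uniqueDiffOn_Icc zero_lt_one) le_rfl

lemma isWeakDeriv_of_hasDerivWithinAt {f f' : ℝ → ℝ}
    (hf : ∀ x ∈ Icc (0 : ℝ) 1, HasDerivWithinAt f (f' x) (Icc 0 1) x)
    (hf' : ContinuousOn f' (Icc 0 1)) : IsWeakDeriv 1 f f' := by
  intro ψ hψ
  have e := intervalIntegral.integral_mul_deriv_eq_deriv_mul_of_hasDerivAt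
      (a := 0) (b := 1) (u := f) (u' := f') (v := ψ) (v' := deriv ψ)
      (by rw [uIcc_of_le zero_le_one]; exact fun x hx => (hf x hx).continuousWithinAt)
      (hψ.smooth.continuous.continuousOn)
      (by
        rw [min_eq_left zero_le_one, max_eq_right zero_le_one]
        exact fun x hx => (hf x (Ioo_subset_Icc_self hx)).hasDerivAt (Icc_mem_nhds hx.1 hx.2))
      (fun x _ => (hψ.smooth.differentiable (by simp) x).hasDerivAt)
      (ContinuousOn.intervalIntegrable (by rwa [uIcc_of_le zero_le_one]))
      (hψ.deriv.smooth.continuous.intervalIntegrable _ _)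
  rw [hψ.endpoints_eq_zero.1, hψ.endpoints_eq_zero.2] at e
  rw [iteratedDeriv_one, integral_μI, integral_μI, e]
  ring

lemma H02.isWeakDeriv_one (f : H02) : IsWeakDeriv 1 f (derivWithin f (Icc 0 1)) :=
  isWeakDeriv_of_hasDerivWithinAt (fun _ hx => f.hasDerivWithinAt hx) f.continuousOn_derivWithin

lemma H02.isWeakDeriv_two (f : H02) : IsWeakDeriv 1 (derivWithin f (Icc 0 1)) (D f) :=
  f.isWeakDeriv_one.of_succ (weakD2_spec f.prop.1)

/-- The two sides have the same weak derivative, and the boundary condition at 0 removes the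
constant. -/
lemma H02.derivWithin_eq (f : H02) {x : ℝ} (hx : x ∈ Icc (0 : ℝ) 1) :
    derivWithin f (Icc 0 1) x = ext (V (D f)) x := by
  obtain ⟨c, hc⟩ := f.isWeakDeriv_two.eq_const_add (memLp_of_continuousOn f.continuousOn_derivWithin)
  have h := eqOn_Icc_of_ae_eq f.continuousOn_derivWithin
    (continuousOn_const.add (ext_continuous _).continuousOn) hc
  have h0 : derivWithin f (Icc 0 1) 0 = c + ext (V (D f)) 0 := h (left_mem_Icc.2 zero_le_one)
  rw [f.prop.2.2.2.2.1, ext_V _ (left_mem_Icc.2 zero_le_one), intervalIntegral.integral_same] at h0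
  have hx' : derivWithin f (Icc 0 1) x = c + ext (V (D f)) x := h hx
  linarith

/-- The right end point of `[0,1]`. -/
def pt1 : Icc (0 : ℝ) 1 := ⟨1, right_mem_Icc.2 zero_le_one⟩

lemma V_ι_apply (c : CI) (y : Icc (0 : ℝ) 1) : V (ι c) y = ∫ x in (0 : ℝ)..y, ext c x := by
  rw [V_apply]
  exact integral_congr_μI (coeFn_ι c) y.2

lemma hasDerivAt_primitive_ext (c : CI) (x : ℝ) :
    HasDerivAt (fun x => ∫ y in (0 : ℝ)..x, ext c y) (ext c x) x :=
  ((ext_continuous c).integral_hasStrictDerivAt 0 x).hasDerivAt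

/-- Functions in `L^2(0,1)` orthogonal to affine functions are second derivatives. -/
lemma exists_D_eq {κ : L2} (h1 : V κ pt1 = 0) (h2 : V (ι (V κ)) pt1 = 0) : ∃ f : H02, D f = κ := by
  classical
  set f : ℝ → ℝ := fun x => if x ∈ Icc (0 : ℝ) 1 then ∫ y in (0 : ℝ)..x, ext (V κ) y else 0 with hf
  have hder : ∀ x ∈ Icc (0 : ℝ) 1, HasDerivWithinAt f (ext (V κ) x) (Icc 0 1) x := by
    intro x hx
    refine (hasDerivAt_primitive_ext (V κ) x).hasDerivWithinAt.congr ?_ ?_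
    · intro y hy
      rw [hf]
      exact if_pos hy
    · exact if_pos hx
  have hd : ∀ x ∈ Icc (0 : ℝ) 1, derivWithin f (Icc 0 1) x = ext (V κ) x := fun x hx =>
    (hder x hx).derivWithin (uniqueDiffOn_Icc zero_lt_one x hx)
  have hc : ContDiffOn ℝ 1 f (Icc 0 1) := by
    rw [contDiffOn_one_iff_derivWithin (uniqueDiffOn_Icc zero_lt_one)]
    exact ⟨fun x hx => (hder x hx).differentiableWithinAt,
      (ext_continuous (V κ)).continuousOn.congr hd⟩
  have w1 : IsWeakDeriv 1 f (ext (V κ)) :=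
    isWeakDeriv_of_hasDerivWithinAt hder (ext_continuous _).continuousOn
  have w2 : IsWeakDeriv 2 f κ := w1.succ (isWeakDeriv_V κ)
  have hm : MemLp f 2 μI := memLp_of_continuousOn hc.continuousOn
  have hmem : MemH 2 f := by
    refine ⟨hm, fun k hk => ?_⟩
    interval_cases k
    · exact ⟨f, hm, isWeakDeriv_zero f⟩
    · exact ⟨_, memLp_ext _, w1⟩
    · exact ⟨_, Lp.memLp κ, w2⟩
  refine ⟨⟨f, hmem, hc, ?_, ?_, ?_, ?_, fun x hx => if_neg hx⟩, weakD2_unique (weakD2_spec hmem) w2⟩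
  · simp [hf]
  · rw [V_ι_apply] at h2
    have : f 1 = ∫ y in (0 : ℝ)..1, ext (V κ) y := if_pos (right_mem_Icc.2 zero_le_one)
    rw [this]
    exact h2
  · rw [hd 0 (left_mem_Icc.2 zero_le_one), ext_V _ (left_mem_Icc.2 zero_le_one),
      intervalIntegral.integral_same]
  · rw [hd 1 (right_mem_Icc.2 zero_le_one), ext_of_mem _ (right_mem_Icc.2 zero_le_one)]
    exact h1


/-! ### The derivative, its reciprocal, and quotients by it -/

lemma AbsolutelyContinuousOnInterval.of_dist_le {f g : ℝ → ℝ} {a b C : ℝ}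
    (hf : AbsolutelyContinuousOnInterval f a b)
    (h : ∀ x ∈ uIcc a b, ∀ y ∈ uIcc a b, dist (g x) (g y) ≤ C * dist (f x) (f y)) :
    AbsolutelyContinuousOnInterval g a b := by
  rw [absolutelyContinuousOnInterval_iff] at hf ⊢
  intro ε hε
  obtain ⟨δ, hδ, H⟩ := hf (ε / (|C| + 1)) (by positivity)
  refine ⟨δ, hδ, fun P hP hPδ => ?_⟩
  have h1 := H P hP hPδ
  rw [lt_div_iff₀ (by positivity)] at h1
  refine lt_of_le_of_lt ?_ h1
  rw [Finset.sum_mul]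
  refine Finset.sum_le_sum fun i hi => ?_
  refine (h _ (hP.1 i hi).1 _ (hP.1 i hi).2).trans ?_
  rw [mul_comm]
  refine mul_le_mul_of_nonneg_left ?_ dist_nonneg
  linarith [le_abs_self C]

/-- The derivative `1 + ∫ F` of the map with second derivative `F`. -/
def E (F : L2) : CI := 1 + V F

/-- The reciprocal of `E F`. -/
def R (F : L2) : CI := Ring.inverse (E F)

/-- The derivative of `V X / E F`. -/
def zf (F X : L2) : L2 := R F • X - (V X * R F ^ 2) • F

/-- The second derivative of `u` composed with `φ`, where `X = u ∘ φ`. -/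
def wf (F X : L2) : L2 := R F • zf F X

lemma ext_E (F : L2) (x : ℝ) : ext (E F) x = 1 + ext (V F) x := rfl

lemma R_mul_E {F : L2} (h : IsUnit (E F)) : R F * E F = 1 := Ring.inverse_mul_cancel _ h

lemma E_mul_R {F : L2} (h : IsUnit (E F)) : E F * R F = 1 := Ring.mul_inverse_cancel _ h

lemma E_smul_wf {F : L2} (h : IsUnit (E F)) (X : L2) : E F • wf F X = zf F X := by
  rw [wf, smul_smul, E_mul_R h, one_smul]

lemma ext_R {F : L2} (h : IsUnit (E F)) (x : ℝ) : ext (R F) x = (ext (E F) x)⁻¹ := by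
  have e : ext (R F) x * ext (E F) x = 1 := congrFun (congrArg ext (R_mul_E h)) x
  exact eq_inv_of_mul_eq_one_left e

lemma ext_E_ne_zero {F : L2} (h : IsUnit (E F)) (x : ℝ) : ext (E F) x ≠ 0 := by
  have e : ext (R F) x * ext (E F) x = 1 := congrFun (congrArg ext (R_mul_E h)) x
  exact right_ne_zero_of_mul_eq_one e

/-- The fundamental theorem of calculus for the reciprocal of φ_x, which stays absolutely continuous
because φ_x is bounded away from zero on [0,1]. -/
lemma R_eq {F : L2} (h : IsUnit (E F)) : R F = 1 - V (R F ^ 2 • F) := by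
  ext x
  have hx := x.2
  have hi := intervalIntegrable_of_μI' F.integrable hx
  have hsub : ∀ y ∈ uIcc (0 : ℝ) x, y ∈ Icc (0 : ℝ) 1 := fun y hy => by
    rw [uIcc_of_le hx.1] at hy
    exact ⟨hy.1, hy.2.trans hx.2⟩
  have hE : ∀ y ∈ uIcc (0 : ℝ) x, ext (E F) y = 1 + ∫ s in (0 : ℝ)..y, F s := fun y hy => by
    rw [ext_E, ext_V _ (hsub y hy)]
  have hac := hi.absolutelyContinuousOnInterval_intervalIntegral (c := 0) (by simp)
  set g : ℝ → ℝ := fun y => (1 + ∫ s in (0 : ℝ)..y, F s)⁻¹ with hg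
  have hgR : ∀ y ∈ uIcc (0 : ℝ) x, g y = ext (R F) y := fun y hy => by
    rw [ext_R h, hE y hy]
  have hgac : AbsolutelyContinuousOnInterval g 0 x := by
    -- From 1/a - 1/b = (b - a) / (ab), with both reciprocals bounded by the sup norm of `R F`.
    apply AbsolutelyContinuousOnInterval.of_dist_le (C := ‖R F‖ * ‖R F‖) hac
    intro y hy y' hy'
    have e1 := ext_E_ne_zero h y
    have e2 := ext_E_ne_zero h y'
    have : g y - g y' = ext (R F) y * ext (R F) y' *
        ((∫ s in (0 : ℝ)..y', F s) - ∫ s in (0 : ℝ)..y, F s) := by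
      rw [hgR y hy, hgR y' hy', ext_R h, ext_R h]
      have a := hE y hy
      have b := hE y' hy'
      field_simp
      rw [a, b]
      ring
    rw [Real.dist_eq, this, abs_mul, abs_mul, dist_comm, Real.dist_eq]
    gcongr
    · exact abs_ext_le _ _
    · exact abs_ext_le _ _
  have e := hgac.integral_deriv_eq_sub
  have e2 : ∫ y in (0 : ℝ)..x, deriv g y = ∫ y in (0 : ℝ)..x, -(R F ^ 2 • F : L2) y := by
    have hco : ∀ᵐ y ∂volume, y ∈ Ioo (0 : ℝ) 1 →
        (R F ^ 2 • F : L2) y = ext (R F ^ 2) y * F y :=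
      (ae_restrict_iff' measurableSet_Ioo).1 (coeFn_smulCI (R F ^ 2) F)
    -- The relation on `μI` holds on the open interval, while the half-open integration interval may
    -- contain 1.
    have hne : ∀ᵐ y ∂volume, y ≠ (1 : ℝ) := by simp [ae_iff]
    apply intervalIntegral.integral_congr_ae
    filter_upwards [hi.ae_hasDerivAt_integral, hco, hne] with y h1 h2 h3 hy
    have hy' := uIoc_subset_uIcc hy
    have hy01 : y ∈ Ioo (0 : ℝ) 1 := by
      rw [uIoc_of_le hx.1] at hy
      exact ⟨hy.1, lt_of_le_of_ne (hy.2.trans hx.2) h3⟩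
    have hne0 : (1 + ∫ s in (0 : ℝ)..y, F s) ≠ 0 := by
      rw [← hE y hy']
      exact ext_E_ne_zero h y
    have hdg : HasDerivAt g (-F y / (1 + ∫ s in (0 : ℝ)..y, F s) ^ 2) y :=
      ((h1 hy' 0 (by simp)).const_add 1).fun_inv hne0
    rw [hdg.deriv, h2 hy01]
    have : ext (R F ^ 2) y = ext (R F) y ^ 2 := rfl
    rw [this, ← hgR y hy', hg]
    field_simp
  rw [e2, intervalIntegral.integral_neg, hgR _ right_mem_uIcc] at e
  have g0 : g 0 = 1 := by simp [hg]
  rw [g0, ext_of_mem _ hx] at e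
  rw [ContinuousMap.sub_apply, V_apply]
  simp only [ContinuousMap.one_apply]
  linarith

/-- The quotient rule for u_x ∘ φ = φ_tx / φ_x, obtained from the product rule and the formula
`R_eq` for the reciprocal. -/
lemma V_zf {F : L2} (h : IsUnit (E F)) (X : L2) : V (zf F X) = V X * R F := by
  have e := R_eq h
  have e1 : V X * R F = V X - V X * V (R F ^ 2 • F) := by
    conv_lhs => rw [e]
    ring
  rw [e1, V_mul_V, zf, map_sub, smul_smul]
  have e2 : V (R F • X) = V X - V (V (R F ^ 2 • F) • X) := by
    conv_lhs => rw [e]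
    rw [sub_smul, one_smul, map_sub]
  rw [e2]
  abel

lemma pos_ext_E {f : H02} (hf : f ∈ Diff02) {x : ℝ} (hx : x ∈ Icc (0 : ℝ) 1) :
    0 < ext (E (D f)) x := by
  rw [ext_E, ← f.derivWithin_eq hx]
  exact hf x hx

lemma isUnit_E {f : H02} (hf : f ∈ Diff02) : IsUnit (E (D f)) := by
  rw [ContinuousMap.isUnit_iff_forall_ne_zero]
  intro x
  rw [← ext_of_mem _ x.2]
  exact (pos_ext_E hf x.2).ne'

/-! ### The change of variables -/

lemma toMap_hasDerivWithinAt (f : H02) {x : ℝ} (hx : x ∈ Icc (0 : ℝ) 1) :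
    HasDerivWithinAt (toMap f) (ext (E (D f)) x) (Icc 0 1) x := by
  rw [ext_E, ← f.derivWithin_eq hx]
  exact (hasDerivWithinAt_id x _).add (f.hasDerivWithinAt hx)

lemma toMap_continuousOn (f : H02) : ContinuousOn (toMap f) (Icc 0 1) :=
  fun _ hx => (toMap_hasDerivWithinAt f hx).continuousWithinAt

lemma toMap_hasDerivAt (f : H02) {x : ℝ} (hx : x ∈ Ioo (0 : ℝ) 1) :
    HasDerivAt (toMap f) (ext (E (D f)) x) x :=
  (toMap_hasDerivWithinAt f (Ioo_subset_Icc_self hx)).hasDerivAt (Icc_mem_nhds hx.1 hx.2)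

lemma toMap_zero (f : H02) : toMap f 0 = 0 := by simp [toMap, f.prop.2.2.1]

lemma toMap_one (f : H02) : toMap f 1 = 1 := by simp [toMap, f.prop.2.2.2.1]

lemma toMap_strictMonoOn {f : H02} (hf : f ∈ Diff02) : StrictMonoOn (toMap f) (Icc 0 1) := by
  apply strictMonoOn_of_deriv_pos (convex_Icc 0 1) (toMap_continuousOn f)
  intro x hx
  rw [interior_Icc] at hx
  rw [(toMap_hasDerivAt f hx).deriv]
  exact pos_ext_E hf (Ioo_subset_Icc_self hx)

lemma toMap_mem_Ioo {f : H02} (hf : f ∈ Diff02) {x : ℝ} (hx : x ∈ Ioo (0 : ℝ) 1) :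
    toMap f x ∈ Ioo (0 : ℝ) 1 := by
  have h := toMap_strictMonoOn hf
  have hx' := Ioo_subset_Icc_self hx
  constructor
  · simpa [toMap_zero] using h (left_mem_Icc.2 zero_le_one) hx' hx.1
  · simpa [toMap_one] using h hx' (right_mem_Icc.2 zero_le_one) hx.2

lemma toMap_image_Ioo {f : H02} (hf : f ∈ Diff02) : toMap f '' Ioo 0 1 = Ioo 0 1 := by
  apply subset_antisymm
  · rintro _ ⟨x, hx, rfl⟩
    exact toMap_mem_Ioo hf hx
  · have := intermediate_value_Ioo zero_le_one (toMap_continuousOn f)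
    rwa [toMap_zero, toMap_one] at this

lemma invMap_toMap {f : H02} (hf : f ∈ Diff02) {x : ℝ} (hx : x ∈ Icc (0 : ℝ) 1) :
    invMap f (toMap f x) = x :=
  (toMap_strictMonoOn hf).injOn.leftInvOn_invFunOn hx

lemma invMap_monotoneOn {f : H02} (hf : f ∈ Diff02) : MonotoneOn (invMap f) (Ioo 0 1) := by
  intro y hy y' hy' hyy
  rw [← toMap_image_Ioo hf] at hy hy'
  obtain ⟨x, hx, rfl⟩ := hy
  obtain ⟨x', hx', rfl⟩ := hy'
  rw [invMap_toMap hf (Ioo_subset_Icc_self hx), invMap_toMap hf (Ioo_subset_Icc_self hx')]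
  exact ((toMap_strictMonoOn hf).le_iff_le (Ioo_subset_Icc_self hx) (Ioo_subset_Icc_self hx')).1 hyy

lemma integral_comp_toMap {f : H02} (hf : f ∈ Diff02) (g : ℝ → ℝ) :
    ∫ y, g y ∂μI = ∫ x, ext (E (D f)) x * g (toMap f x) ∂μI := by
  have h := integral_image_eq_integral_abs_deriv_smul (s := Ioo 0 1) measurableSet_Ioo
    (fun x hx => (toMap_hasDerivAt f hx).hasDerivWithinAt)
    ((toMap_strictMonoOn hf).injOn.mono Ioo_subset_Icc_self) g
  rw [toMap_image_Ioo hf] at h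
  rw [h]
  apply setIntegral_congr_fun measurableSet_Ioo
  intro x hx
  simp only [smul_eq_mul, abs_of_pos (pos_ext_E hf (Ioo_subset_Icc_self hx))]

lemma integrable_comp_toMap {f : H02} (hf : f ∈ Diff02) (g : ℝ → ℝ) :
    Integrable g μI ↔ Integrable (fun x => ext (E (D f)) x * g (toMap f x)) μI := by
  have h := integrableOn_image_iff_integrableOn_abs_deriv_smul (s := Ioo 0 1) measurableSet_Ioo
    (fun x hx => (toMap_hasDerivAt f hx).hasDerivWithinAt)
    ((toMap_strictMonoOn hf).injOn.mono Ioo_subset_Icc_self) g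
  rw [toMap_image_Ioo hf] at h
  rw [← IntegrableOn, h]
  apply integrableOn_congr_fun _ measurableSet_Ioo
  intro x hx
  simp only [smul_eq_mul, abs_of_pos (pos_ext_E hf (Ioo_subset_Icc_self hx))]

/-- Measurability comes from the monotonicity of φ⁻¹; square integrability from the change of
variables, whose Jacobian φ_x is bounded. -/
lemma memLp_comp_invMap {f : H02} (hf : f ∈ Diff02) (u : L2) : MemLp (u ∘ invMap f) 2 μI := by
  have hm : AEStronglyMeasurable (u ∘ invMap f) μI :=
    ((Lp.stronglyMeasurable u).measurable.comp_aemeasurable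
      (aemeasurable_restrict_of_monotoneOn measurableSet_Ioo
        (invMap_monotoneOn hf))).aestronglyMeasurable
  rw [memLp_two_iff_integrable_sq hm, integrable_comp_toMap hf]
  have hi := integrable_ext_mul (E (D f)) (u.integrable_mul u)
  refine hi.congr ?_
  filter_upwards [ae_restrict_mem measurableSet_Ioo] with x hx
  rw [Function.comp_apply, invMap_toMap hf (Ioo_subset_Icc_self hx), sq]

/-- The chain rule (p ∘ φ⁻¹)' = (p' / φ_x) ∘ φ⁻¹ in weak form. After substituting y = φ(x), the test
function becomes ψ ∘ φ, which is only C¹, so the integration by parts is done with primitives. -/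
lemma isWeakDeriv_comp_invMap {f : H02} (hf : f ∈ Diff02) {p q : ℝ → ℝ} {u : L2}
    (hp : p =ᵐ[μI] ext (V u)) (hq : (fun x => ext (E (D f)) x * q x) =ᵐ[μI] u) :
    IsWeakDeriv 1 (p ∘ invMap f) (q ∘ invMap f) := by
  intro ψ hψ
  set g : ℝ → ℝ := fun x => ext (E (D f)) x * deriv ψ (toMap f x) with hg
  have hcomp : ContinuousOn (fun x => deriv ψ (toMap f x)) (Icc 0 1) :=
    hψ.deriv.smooth.continuous.comp_continuousOn (toMap_continuousOn f)
  have hgi : Integrable g μI :=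
    integrable_ext_mul _ ((memLp_of_continuousOn hcomp).integrable (by norm_num))
  have hprim : ∀ x ∈ Icc (0 : ℝ) 1, ∫ y in (0 : ℝ)..x, g y = ψ (toMap f x) := by
    intro x hx
    have := intervalIntegral.integral_eq_sub_of_hasDerivAt_of_le (a := 0) (b := x)
      (f := fun x => ψ (toMap f x)) (f' := g) hx.1
      ((hψ.smooth.continuous.comp_continuousOn (toMap_continuousOn f)).mono
        (Icc_subset_Icc_right hx.2))
      (fun y hy => by
        have h1 := (hψ.smooth.differentiable (by simp) (toMap f y)).hasDerivAt
        rw [hg]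
        simp only [mul_comm (ext (E (D f)) y)]
        exact h1.comp y (toMap_hasDerivAt f ⟨hy.1, hy.2.trans_le hx.2⟩))
      (intervalIntegrable_of_μI' hgi hx)
    rw [this, toMap_zero, hψ.endpoints_eq_zero.1, sub_zero]
  have e := mul_primitive_eq u.integrable hgi (right_mem_Icc.2 zero_le_one)
  rw [hprim 1 (right_mem_Icc.2 zero_le_one), toMap_one, hψ.endpoints_eq_zero.2, mul_zero,
    ← integral_μI] at e
  have hψm : MemLp (fun x => ψ (toMap f x)) 2 μI := memLp_of_continuousOn
    (hψ.smooth.continuous.comp_continuousOn (toMap_continuousOn f))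
  have e2 : ∫ y, (u y * ∫ s in (0 : ℝ)..y, g s) + (∫ s in (0 : ℝ)..y, u s) * g y ∂μI =
      ∫ y, u y * ψ (toMap f y) + ext (V u) y * g y ∂μI := by
    apply integral_congr_ae
    filter_upwards [ae_restrict_mem measurableSet_Ioo] with y hy
    rw [ext_V _ (Ioo_subset_Icc_self hy), hprim y (Ioo_subset_Icc_self hy)]
  have hi1 : Integrable (fun y => u y * ψ (toMap f y)) μI := (Lp.memLp u).integrable_mul hψm
  rw [e2, integral_add hi1 (integrable_ext_mul _ hgi)] at e
  rw [iteratedDeriv_one, integral_comp_toMap hf (fun y => (p ∘ invMap f) y * deriv ψ y),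
    integral_comp_toMap hf (fun y => (q ∘ invMap f) y * ψ y)]
  have e3 : ∫ x, ext (E (D f)) x * ((p ∘ invMap f) (toMap f x) * deriv ψ (toMap f x)) ∂μI
      = ∫ y, ext (V u) y * g y ∂μI := by
    apply integral_congr_ae
    filter_upwards [hp, ae_restrict_mem measurableSet_Ioo] with y h hy
    rw [Function.comp_apply, invMap_toMap hf (Ioo_subset_Icc_self hy), h, hg]
    ring
  have e4 : ∫ x, ext (E (D f)) x * ((q ∘ invMap f) (toMap f x) * ψ (toMap f x)) ∂μI
      = ∫ y, u y * ψ (toMap f y) ∂μI := by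
    apply integral_congr_ae
    filter_upwards [hq, ae_restrict_mem measurableSet_Ioo] with y h hy
    rw [Function.comp_apply, invMap_toMap hf (Ioo_subset_Icc_self hy), ← h]
    ring
  rw [e3, e4]
  linarith

lemma H02.ae_eq_primitive (f : H02) : f =ᵐ[μI] ext (V (ι (V (D f)))) := by
  filter_upwards [ae_restrict_mem measurableSet_Ioo] with x hx
  have hx' := Ioo_subset_Icc_self hx
  rw [ext_of_mem _ hx', V_ι_apply]
  have := intervalIntegral.integral_eq_sub_of_hasDerivAt_of_le (a := 0) (b := x) (f := f)
    (f' := ext (V (D f))) hx.1.le (f.contDiffOn.continuousOn.mono (Icc_subset_Icc_right hx.2.le))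
    (fun y hy => by
      have hy' : y ∈ Ioo (0 : ℝ) 1 := ⟨hy.1, hy.2.trans hx.2⟩
      rw [← f.derivWithin_eq (Ioo_subset_Icc_self hy')]
      exact (f.hasDerivWithinAt (Ioo_subset_Icc_self hy')).hasDerivAt (Icc_mem_nhds hy'.1 hy'.2))
    ((ext_continuous _).intervalIntegrable _ _)
  rw [f.prop.2.2.1, sub_zero] at this
  exact this.symm

/-- The metric in terms of second derivatives. -/
lemma metricG_self {f : H02} (hf : f ∈ Diff02) (X : H02) :
    metricG f X X = B (zf (D f) (D X)) (wf (D f) (D X)) pt1 := by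
  have hu := isUnit_E hf
  set w := wf (D f) (D X) with hw
  have w1 : IsWeakDeriv 1 (X ∘ invMap f) (ext (V (D X) * R (D f)) ∘ invMap f) := by
    apply isWeakDeriv_comp_invMap hf X.ae_eq_primitive
    filter_upwards [coeFn_ι (V (D X))] with x hx
    have e : ext (R (D f)) x * ext (E (D f)) x = 1 := congrFun (congrArg ext (R_mul_E hu)) x
    have e' : ext (V (D X) * R (D f)) x = ext (V (D X)) x * ext (R (D f)) x := rfl
    rw [hx, e']
    linear_combination ext (V (D X)) x * e
  have w2 : IsWeakDeriv 1 (ext (V (D X) * R (D f)) ∘ invMap f) (w ∘ invMap f) := by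
    apply isWeakDeriv_comp_invMap hf (u := zf (D f) (D X))
    · rw [V_zf hu]
    · rw [← E_smul_wf hu]
      exact (coeFn_smulCI _ _).symm
  have hm := memLp_comp_invMap hf w
  have hw2 : IsWeakDeriv 2 (X ∘ invMap f) (hm.toLp _) := (w1.succ w2).congr hm.coeFn_toLp.symm
  -- Full H² membership of the composition is not needed: one L² second derivative determines the
  -- choice.
  have hd : weakD2 (X ∘ invMap f) = hm.toLp _ := by
    have hex : ∃ g : Lp ℝ 2 μI, IsWeakDeriv 2 (X ∘ invMap f) g := ⟨_, hw2⟩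
    rw [weakD2, dif_pos hex]
    exact weakD2_unique hex.choose_spec hw2
  rw [metricG, innerH02, hd, ← E_smul_wf hu, B_apply, pt1, ← integral_μI]
  have e1 : ∫ x, (hm.toLp _ : L2) x * (hm.toLp _ : L2) x ∂μI =
      ∫ x, (w ∘ invMap f) x * (w ∘ invMap f) x ∂μI := by
    apply integral_congr_ae
    filter_upwards [hm.coeFn_toLp] with x hx
    rw [hx]
  rw [e1, integral_comp_toMap hf]
  apply integral_congr_ae
  filter_upwards [coeFn_smulCI (E (D f)) w, ae_restrict_mem measurableSet_Ioo] with x hx hx'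
  rw [hx, Function.comp_apply, invMap_toMap hf (Ioo_subset_Icc_self hx')]
  ring


/-! ### The energy density and the first variation -/

lemma B_pt1 (u v : L2) : B u v pt1 = inner ℝ u v := by
  rw [B_apply, pt1, ← integral_μI, L2.inner_def]
  simp [mul_comm]

lemma E_hasDerivWithinAt {F : ℝ → L2} {F' : L2} {S : Set ℝ} {t : ℝ}
    (hF : HasDerivWithinAt F F' S t) : HasDerivWithinAt (fun s => E (F s)) (V F') S t :=
  (V.hasFDerivAt.comp_hasDerivWithinAt t hF).const_add 1

lemma R_hasDerivWithinAt {F : ℝ → L2} {F' : L2} {S : Set ℝ} {t : ℝ}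
    (hF : HasDerivWithinAt F F' S t) (hu : IsUnit (E (F t))) :
    HasDerivWithinAt (fun s => R (F s)) (-(V F' * R (F t) ^ 2)) S t := by
  obtain ⟨x, hx⟩ := hu
  have h := hasFDerivAt_ringInverse (𝕜 := ℝ) x
  rw [hx] at h
  refine (h.comp_hasDerivWithinAt t (E_hasDerivWithinAt hF)).congr_deriv ?_
  have e : R (F t) = ↑x⁻¹ := by rw [R, ← hx, Ring.inverse_unit]
  simp [e]
  ring

lemma R_continuousOn {Y : Type*} [TopologicalSpace Y] {S : Set Y} {F : Y → L2}
    (hF : ContinuousOn F S) (hu : ∀ y ∈ S, IsUnit (E (F y))) :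
    ContinuousOn (fun y => R (F y)) S := by
  intro y hy
  obtain ⟨x, hx⟩ := hu y hy
  have h := NormedRing.inverse_continuousAt x
  rw [hx] at h
  have hE : ContinuousWithinAt (fun y => E (F y)) S y :=
    continuousWithinAt_const.add (V.continuous.continuousAt.comp_continuousWithinAt (hF y hy))
  exact ContinuousAt.comp_continuousWithinAt h hE

lemma zf_continuousOn {Y : Type*} [TopologicalSpace Y] {S : Set Y} {F X : Y → L2}
    (hF : ContinuousOn F S) (hX : ContinuousOn X S) (hu : ∀ y ∈ S, IsUnit (E (F y))) :
    ContinuousOn (fun y => zf (F y) (X y)) S := by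
  have hR := R_continuousOn hF hu
  unfold zf
  fun_prop

lemma wf_continuousOn {Y : Type*} [TopologicalSpace Y] {S : Set Y} {F X : Y → L2}
    (hF : ContinuousOn F S) (hX : ContinuousOn X S) (hu : ∀ y ∈ S, IsUnit (E (F y))) :
    ContinuousOn (fun y => wf (F y) (X y)) S :=
  (R_continuousOn hF hu).smul (zf_continuousOn hF hX hu)

/-- The derivative of `zf` at `(F, X)` in the direction `(h, k)`. -/
def dz (F X h k : L2) : L2 := zf F k - (V h * R F) • zf F X - (V X * R F) • zf F h

lemma zf_hasDerivWithinAt {F X : ℝ → L2} {F' X' : L2} {S : Set ℝ} {t : ℝ}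
    (hF : HasDerivWithinAt F F' S t) (hX : HasDerivWithinAt X X' S t) (hu : IsUnit (E (F t))) :
    HasDerivWithinAt (fun s => zf (F s) (X s)) (dz (F t) (X t) F' X') S t := by
  have hR := R_hasDerivWithinAt hF hu
  have hVX : HasDerivWithinAt (fun s => V (X s)) (V X') S t :=
    V.hasFDerivAt.comp_hasDerivWithinAt t hX
  have h := (hR.smul hX).sub ((hVX.mul (hR.mul hR)).smul hF)
  have e : (fun s => zf (F s) (X s)) = (fun s => R (F s)) • X -
      ((fun s => V (X s)) * ((fun s => R (F s)) * fun s => R (F s))) • F := by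
    funext s
    simp [zf, sq]
  rw [e]
  refine h.congr_deriv ?_
  simp only [dz, zf, Pi.mul_apply]
  module

/-- The energy density. -/
def density (F X : L2) : ℝ := inner ℝ (zf F X) (wf F X)

/-- The derivative of the energy density at `(F, X)` in the direction `(h, k)`. -/
def dDensity (F X h k : L2) : ℝ :=
  2 * inner ℝ (wf F X) (dz F X h k) - inner ℝ (wf F X) (V h • wf F X)

lemma inner_smulCI (c : CI) (u v : L2) : inner ℝ (c • u) v = inner ℝ u (c • v) := by
  rw [← B_pt1, B_smul_comm, B_pt1]

/-- Multiplication by `R F` is self-adjoint, so the two slots of ⟨z, R z⟩ contribute equally; the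
derivative of `R F` itself produces the last term of `dDensity`. -/
lemma density_hasDerivAt {F X : ℝ → L2} {F' X' : L2} {t : ℝ}
    (hF : HasDerivAt F F' t) (hX : HasDerivAt X X' t) (hu : IsUnit (E (F t))) :
    HasDerivAt (fun s => density (F s) (X s)) (dDensity (F t) (X t) F' X') t := by
  rw [← hasDerivWithinAt_univ] at *
  have hz := zf_hasDerivWithinAt hF hX hu
  have hR := R_hasDerivWithinAt hF hu
  have h := hz.inner ℝ (hR.smul hz)
  refine HasDerivWithinAt.congr_deriv h ?_
  have e : (V F' * R (F t) ^ 2) • zf (F t) (X t) = (V F' * R (F t)) • wf (F t) (X t) := by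
    rw [wf, smul_smul, mul_assoc, sq]
  simp only [inner_add_right, neg_smul, inner_neg_right, Pi.smul_apply', dDensity]
  rw [e, ← inner_smulCI (R (F t)) (zf _ _), ← wf, mul_comm (V F'), mul_smul,
    ← inner_smulCI (R (F t)) (zf _ _), ← wf, real_inner_comm (wf (F t) (X t)) (dz _ _ _ _)]
  ring

lemma density_continuousOn {Y : Type*} [TopologicalSpace Y] {S : Set Y} {F X : Y → L2}
    (hF : ContinuousOn F S) (hX : ContinuousOn X S) (hu : ∀ y ∈ S, IsUnit (E (F y))) :
    ContinuousOn (fun y => density (F y) (X y)) S :=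
  (zf_continuousOn hF hX hu).inner (wf_continuousOn hF hX hu)

lemma dDensity_continuousOn {Y : Type*} [TopologicalSpace Y] {S : Set Y} {F X h k : Y → L2}
    (hF : ContinuousOn F S) (hX : ContinuousOn X S) (hh : ContinuousOn h S)
    (hk : ContinuousOn k S) (hu : ∀ y ∈ S, IsUnit (E (F y))) :
    ContinuousOn (fun y => dDensity (F y) (X y) (h y) (k y)) S := by
  have hR := R_continuousOn hF hu
  have hzX := zf_continuousOn hF hX hu
  have hzh := zf_continuousOn hF hh hu
  have hzk := zf_continuousOn hF hk hu
  have hw := wf_continuousOn hF hX hu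
  unfold dDensity dz
  fun_prop

lemma mem_Diff02_of_pos {f : H02} (h : ∀ x ∈ Icc (0 : ℝ) 1, 0 < ext (E (D f)) x) :
    f ∈ Diff02 := by
  intro x hx
  rw [f.derivWithin_eq hx, ← ext_E]
  exact h x hx

lemma IsGeodesic.hasDerivWithinAt {γ : ℝ → H02} (hγ : IsGeodesic γ) {t : ℝ} (ht : t ∈ Icc (0 : ℝ) 1) :
    HasDerivWithinAt γ (velocity γ t) (Icc 0 1) t :=
  (hγ.contDiff.differentiableOn one_ne_zero t ht).hasDerivWithinAt

lemma IsGeodesic.continuousOn {γ : ℝ → H02} (hγ : IsGeodesic γ) : ContinuousOn γ (Icc 0 1) := hγ.contDiff.continuousOn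

lemma IsGeodesic.continuousOn_velocity {γ : ℝ → H02} (hγ : IsGeodesic γ) : ContinuousOn (velocity γ) (Icc 0 1) :=
  hγ.contDiff.continuousOn_derivWithin (uniqueDiffOn_Icc zero_lt_one) le_rfl

lemma IsGeodesic.isUnit {γ : ℝ → H02} (hγ : IsGeodesic γ) {t : ℝ} (ht : t ∈ Icc (0 : ℝ) 1) : IsUnit (E (D (γ t))) :=
  isUnit_E (hγ.mem t ht)

lemma IsGeodesic.hasDerivWithinAt_D {γ : ℝ → H02} (hγ : IsGeodesic γ) {t : ℝ} (ht : t ∈ Icc (0 : ℝ) 1) :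
    HasDerivWithinAt (fun t => D (γ t)) (D (velocity γ t)) (Icc 0 1) t :=
  D.toContinuousLinearMap.hasFDerivAt.comp_hasDerivWithinAt t (hγ.hasDerivWithinAt ht)

lemma IsGeodesic.continuousOn_D {γ : ℝ → H02} (hγ : IsGeodesic γ) : ContinuousOn (fun t => D (γ t)) (Icc 0 1) :=
  D.continuous.comp_continuousOn hγ.continuousOn

lemma IsGeodesic.continuousOn_D_velocity {γ : ℝ → H02} (hγ : IsGeodesic γ) : ContinuousOn (fun t => D (velocity γ t)) (Icc 0 1) :=
  D.continuous.comp_continuousOn hγ.continuousOn_velocity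

/-- By compactness of the time interval, φ_x is bounded below uniformly in x and t, and small
perturbations keep it positive. -/
lemma IsGeodesic.exists_variation_mem {γ : ℝ → H02} (hγ : IsGeodesic γ) {h : ℝ → H02} (hh : Continuous h) :
    ∃ δ > 0, ∀ s : ℝ, |s| ≤ δ → ∀ t ∈ Icc (0 : ℝ) 1, γ t + s • h t ∈ Diff02 := by
  obtain ⟨C, hC⟩ := isCompact_Icc.exists_bound_of_continuousOn
    (R_continuousOn hγ.continuousOn_D fun t ht => hγ.isUnit ht)
  obtain ⟨C', hC'⟩ := isCompact_Icc.exists_bound_of_continuousOn (s := Icc (0 : ℝ) 1)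
    (f := fun t => V (D (h t))) (by fun_prop)
  have hC0 : 0 ≤ C := (norm_nonneg _).trans (hC 0 (by simp))
  have hC0' : 0 ≤ C' := (norm_nonneg _).trans (hC' 0 (by simp))
  -- C bounds 1/φ_x and C' bounds h_x. Then |s h_x| ≤ C' / (C C' + 1) < φ_x, because C φ_x ≥ 1; the
  -- added 1 also covers C' = 0.
  refine ⟨1 / (C * C' + 1), by positivity, fun s hs t ht => mem_Diff02_of_pos fun x hx => ?_⟩
  have hp := pos_ext_E (hγ.mem t ht) hx
  have hR := ext_R (hγ.isUnit ht) x
  have h1 : ext (E (D (γ t + s • h t))) x = ext (E (D (γ t))) x + s * ext (V (D (h t))) x := by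
    rw [map_add, map_smul, E, E, map_add, map_smul, ← add_assoc]
    rfl
  have h2 : (ext (E (D (γ t))) x)⁻¹ ≤ C := by
    rw [← hR]
    exact (le_abs_self _).trans ((abs_ext_le _ _).trans (hC t ht))
  have h3 : |s * ext (V (D (h t))) x| ≤ 1 / (C * C' + 1) * C' := by
    rw [abs_mul]
    gcongr
    exact (abs_ext_le _ _).trans (hC' t ht)
  set e := ext (E (D (γ t))) x with he
  have h4 : 1 ≤ C * e := by
    have := mul_le_mul_of_nonneg_right h2 hp.le
    rwa [inv_mul_cancel₀ hp.ne'] at this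
  have h5 : 1 / (C * C' + 1) * C' < e := by
    rw [one_div, inv_mul_lt_iff₀ (by positivity)]
    nlinarith
  rw [h1]
  linarith [neg_abs_le (s * ext (V (D (h t))) x)]

/-- The first variation of the energy. -/
lemma IsGeodesic.integral_dDensity {γ : ℝ → H02} (hγ : IsGeodesic γ) {h : ℝ → H02} (hh : ContDiff ℝ ∞ h) (h0 : h 0 = 0)
    (h1 : h 1 = 0) :
    ∫ t in (0 : ℝ)..1, dDensity (D (γ t)) (D (velocity γ t)) (D (h t)) (D (deriv h t)) = 0 := by
  have hc : Continuous h := hh.continuous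
  have hd : Differentiable ℝ h := hh.differentiable (by simp)
  have hc' : Continuous (deriv h) := hh.continuous_deriv (by exact_mod_cast le_top)
  obtain ⟨δ, hδ, hmem⟩ := hγ.exists_variation_mem hc
  set F : ℝ → ℝ → L2 := fun s t => D (γ t) + s • D (h t) with hF
  set X : ℝ → ℝ → L2 := fun s t => D (velocity γ t) + s • D (deriv h t) with hX
  have hFm : ∀ s t, F s t = D (γ t + s • h t) := fun s t => by simp [hF]
  have hunit : ∀ s, |s| ≤ δ → ∀ t ∈ Icc (0 : ℝ) 1, IsUnit (E (F s t)) := fun s hs t ht => by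
    rw [hFm]
    exact isUnit_E (hmem s hs t ht)
  have hFc : ContinuousOn (fun p : ℝ × ℝ => F p.1 p.2) (Icc (-δ) δ ×ˢ Icc 0 1) := by
    have a := hγ.continuousOn_D.comp (continuous_snd (X := ℝ)).continuousOn
      (fun p (hp : p ∈ Icc (-δ) δ ×ˢ Icc (0 : ℝ) 1) => hp.2)
    exact a.add (by fun_prop)
  have hXc : ContinuousOn (fun p : ℝ × ℝ => X p.1 p.2) (Icc (-δ) δ ×ˢ Icc 0 1) := by
    have a := hγ.continuousOn_D_velocity.comp (continuous_snd (X := ℝ)).continuousOn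
      (fun p (hp : p ∈ Icc (-δ) δ ×ˢ Icc (0 : ℝ) 1) => hp.2)
    exact a.add (by fun_prop)
  have hu2 : ∀ p ∈ Icc (-δ) δ ×ˢ Icc (0 : ℝ) 1, IsUnit (E (F p.1 p.2)) := fun p hp =>
    hunit _ (abs_le.2 hp.1) _ hp.2
  have hdc := dDensity_continuousOn (h := fun p : ℝ × ℝ => D (h p.2))
    (k := fun p : ℝ × ℝ => D (deriv h p.2)) hFc hXc (by fun_prop) (by fun_prop) hu2
  have hec := density_continuousOn hFc hXc hu2
  -- Joint continuity on a compact rectangle supplies the constant that dominates the s-derivative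
  -- under the integral.
  obtain ⟨C, hC⟩ := (isCompact_Icc.prod isCompact_Icc).exists_bound_of_continuousOn hdc
  have hslice : ∀ s, |s| ≤ δ → MapsTo (fun t : ℝ => (s, t)) (Icc 0 1) (Icc (-δ) δ ×ˢ Icc 0 1) :=
    fun s hs t ht => ⟨abs_le.1 hs, ht⟩
  have hec' : ∀ s, |s| ≤ δ → ContinuousOn (fun t => density (F s t) (X s t)) (Icc 0 1) :=
    fun s hs => hec.comp (f := fun t : ℝ => (s, t)) (by fun_prop) (hslice s hs)
  have hdc' : ContinuousOn (fun t => dDensity (F 0 t) (X 0 t) (D (h t)) (D (deriv h t)))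
      (Icc 0 1) :=
    hdc.comp (f := fun t : ℝ => ((0 : ℝ), t)) (by fun_prop) (hslice 0 (by simp [hδ.le]))
  have hsub : uIoc (0 : ℝ) 1 ⊆ Icc 0 1 := by
    rw [uIoc_of_le zero_le_one]; exact Ioc_subset_Icc_self
  have hae : ∀ {g : ℝ → ℝ}, ContinuousOn g (Icc 0 1) →
      AEStronglyMeasurable g (volume.restrict (uIoc 0 1)) := fun hg =>
    (hg.mono hsub).aestronglyMeasurable measurableSet_uIoc
  have hnhds : Ioo (-δ) δ ∈ nhds (0 : ℝ) := Ioo_mem_nhds (by linarith) hδ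
  have hIoo : ∀ s ∈ Ioo (-δ) δ, |s| ≤ δ := fun s hs => (abs_lt.2 hs).le
  have key := intervalIntegral.hasDerivAt_integral_of_dominated_loc_of_deriv_le
    (𝕜 := ℝ) (μ := volume) (a := 0) (b := 1) (x₀ := (0 : ℝ)) (s := Ioo (-δ) δ)
    (bound := fun _ => C)
    (F := fun s t => density (F s t) (X s t))
    (F' := fun s t => dDensity (F s t) (X s t) (D (h t)) (D (deriv h t))) hnhds
    (Filter.eventually_of_mem hnhds fun s hs => hae (hec' s (hIoo s hs)))
    (ContinuousOn.intervalIntegrable (by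
      rw [uIcc_of_le zero_le_one]; exact hec' 0 (by simp [hδ.le])))
    (hae hdc')
    (Filter.Eventually.of_forall fun t ht s hs => hC (s, t) (hslice s (hIoo s hs) (hsub ht)))
    intervalIntegrable_const
    (Filter.Eventually.of_forall fun t ht s hs => by
      have a : HasDerivAt (fun s => F s t) (D (h t)) s := by
        simpa [hF] using ((hasDerivAt_id' s).smul_const (D (h t))).const_add (D (γ t))
      have b : HasDerivAt (fun s => X s t) (D (deriv h t)) s := by
        simpa [hX] using ((hasDerivAt_id' s).smul_const (D (deriv h t))).const_add (D (velocity γ t))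
      exact density_hasDerivAt a b (hunit s (hIoo s hs) t (hsub ht)))
  -- The explicit density represents the energy only while the varied curve stays in the group,
  -- hence only for s near 0.
  have hen : (fun s => energy (fun t => γ t + s • h t)) =ᶠ[nhds 0]
      fun s => (1 / 2) * ∫ t in (0 : ℝ)..1, density (F s t) (X s t) := by
    filter_upwards [hnhds] with s hs
    rw [energy]
    congr 1
    apply intervalIntegral.integral_congr
    intro t ht
    rw [uIcc_of_le zero_le_one] at ht
    have hv : velocity (fun t => γ t + s • h t) t = velocity γ t + s • deriv h t :=
      ((hγ.hasDerivWithinAt ht).add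
        (((hd t).hasDerivAt.const_smul s).hasDerivWithinAt)).derivWithin
        (uniqueDiffOn_Icc zero_lt_one t ht)
    simp only
    rw [metricG_self (hmem s (hIoo s hs) t ht), B_pt1, hv, density, hFm]
    simp [hX]
  have hcrit := (hγ.critical h hh h0 h1).congr_of_eventuallyEq hen.symm
  have := hcrit.unique (key.2.const_mul (1 / 2))
  have h2 : ∫ t in (0 : ℝ)..1, dDensity (F 0 t) (X 0 t) (D (h t)) (D (deriv h t)) = 0 := by
    linarith
  simpa [hF, hX] using h2


/-! ### Momentum and force as functionals -/

/-- `zf F` as a continuous linear map. -/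
def zfL (F : L2) : L2 →L[ℝ] L2 :=
  ContinuousLinearMap.lsmul ℝ CI (R F) -
    (((ContinuousLinearMap.lsmul ℝ CI).flip F).comp (ContinuousLinearMap.mul ℝ CI (R F ^ 2))).comp V

lemma zfL_apply (F X : L2) : zfL F X = zf F X := by
  simp [zfL, zf, mul_comm]

/-- The momentum at `(F, X)`. -/
def momentum (F X : L2) : L2 →L[ℝ] ℝ := (innerSL ℝ (wf F X)).comp (zfL F)

/-- The force at `(F, X)`. -/
def force (F X : L2) : L2 →L[ℝ] ℝ :=
  ((innerSL ℝ (wf F X)).comp (ContinuousLinearMap.lsmul ℝ CI (V X * R F))).comp (zfL F) +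
    (3 / 2 : ℝ) • ((innerSL ℝ (wf F X)).comp
      ((ContinuousLinearMap.lsmul ℝ CI).flip (wf F X))).comp V

lemma momentum_apply (F X k : L2) : momentum F X k = inner ℝ (wf F X) (zf F k) := by
  simp [momentum, zfL_apply]

lemma force_apply (F X h : L2) : force F X h = inner ℝ (wf F X) ((V X * R F) • zf F h) +
    3 / 2 * inner ℝ (wf F X) (V h • wf F X) := by
  simp [force, zfL_apply]

/-- This separates the variation k of the velocity from the variation h of the position. The
coefficient 3/2 in the force adds 1 from the variation of `zf` and 1/2 from the variation of `R`. -/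
lemma dDensity_eq (F X h k : L2) :
    dDensity F X h k = 2 * (momentum F X k - force F X h) := by
  have e : (V h * R F) • zf F X = V h • wf F X := by rw [wf, smul_smul]
  rw [momentum_apply, force_apply, dDensity, dz, e, inner_sub_right, inner_sub_right]
  ring

/-- Continuity in operator norm, not just pointwise, is what later allows the momentum to be paired
with a moving test field. -/
lemma zfL_continuousOn {Y : Type*} [TopologicalSpace Y] {S : Set Y} {F : Y → L2}
    (hF : ContinuousOn F S) (hu : ∀ y ∈ S, IsUnit (E (F y))) :
    ContinuousOn (fun y => zfL (F y)) S := by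
  have hR := R_continuousOn hF hu
  have h1 : ContinuousOn (fun y => ContinuousLinearMap.lsmul ℝ CI (E := L2) (R (F y))) S :=
    (ContinuousLinearMap.lsmul ℝ CI).continuous.comp_continuousOn hR
  have h2 : ContinuousOn (fun y => (ContinuousLinearMap.lsmul ℝ CI (E := L2)).flip (F y)) S :=
    (ContinuousLinearMap.lsmul ℝ CI).flip.continuous.comp_continuousOn hF
  have h3 : ContinuousOn (fun y => ContinuousLinearMap.mul ℝ CI (R (F y) ^ 2)) S :=
    (ContinuousLinearMap.mul ℝ CI).continuous.comp_continuousOn (hR.pow 2)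
  exact h1.sub ((h2.clm_comp h3).clm_comp continuousOn_const)

lemma momentum_continuousOn {Y : Type*} [TopologicalSpace Y] {S : Set Y} {F X : Y → L2}
    (hF : ContinuousOn F S) (hX : ContinuousOn X S) (hu : ∀ y ∈ S, IsUnit (E (F y))) :
    ContinuousOn (fun y => momentum (F y) (X y)) S :=
  ((innerSL ℝ).continuous.comp_continuousOn (wf_continuousOn hF hX hu)).clm_comp
    (zfL_continuousOn hF hu)

lemma force_continuousOn {Y : Type*} [TopologicalSpace Y] {S : Set Y} {F X : Y → L2}
    (hF : ContinuousOn F S) (hX : ContinuousOn X S) (hu : ∀ y ∈ S, IsUnit (E (F y))) :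
    ContinuousOn (fun y => force (F y) (X y)) S := by
  have hR := R_continuousOn hF hu
  have hw := wf_continuousOn hF hX hu
  have h1 : ContinuousOn (fun y => innerSL ℝ (wf (F y) (X y))) S :=
    (innerSL ℝ).continuous.comp_continuousOn hw
  have h2 : ContinuousOn (fun y => ContinuousLinearMap.lsmul ℝ CI (E := L2) (V (X y) * R (F y))) S :=
    (ContinuousLinearMap.lsmul ℝ CI).continuous.comp_continuousOn
      ((V.continuous.comp_continuousOn hX).mul hR)
  have h3 : ContinuousOn (fun y => (ContinuousLinearMap.lsmul ℝ CI (E := L2)).flip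
      (wf (F y) (X y))) S :=
    (ContinuousLinearMap.lsmul ℝ CI).flip.continuous.comp_continuousOn hw
  have h4 : ContinuousOn (fun y => ((innerSL ℝ (wf (F y) (X y))).comp
      ((ContinuousLinearMap.lsmul ℝ CI).flip (wf (F y) (X y)))).comp V) S :=
    (h1.clm_comp h3).clm_comp continuousOn_const
  exact ((h1.clm_comp h2).clm_comp (zfL_continuousOn hF hu)).add (h4.const_smul (3 / 2 : ℝ))

/-! ### One-dimensional calculus on `[0,1]` -/

lemma intervalIntegrable_of_continuousOn {Y : Type*} [NormedAddCommGroup Y]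
    {f : ℝ → Y} (hf : ContinuousOn f (Icc 0 1)) {t : ℝ} (ht : t ∈ Icc (0 : ℝ) 1) :
    IntervalIntegrable f volume 0 t :=
  ContinuousOn.intervalIntegrable (by
    rw [uIcc_of_le ht.1]; exact hf.mono (Icc_subset_Icc_right ht.2))

lemma hasDerivWithinAt_primitive {Y : Type*} [NormedAddCommGroup Y] [NormedSpace ℝ Y]
    [CompleteSpace Y] {f : ℝ → Y} (hf : ContinuousOn f (Icc 0 1)) {t : ℝ}
    (ht : t ∈ Icc (0 : ℝ) 1) :
    HasDerivWithinAt (fun t => ∫ s in (0 : ℝ)..t, f s) (f t) (Icc 0 1) t := by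
  set g : ℝ → Y := IccExtend zero_le_one ((Icc (0 : ℝ) 1).domRestrict f) with hg
  have hgc : Continuous g := (continuousOn_iff_continuous_domRestrict.1 hf).Icc_extend'
  have hgf : ∀ s ∈ Icc (0 : ℝ) 1, g s = f s := fun s hs => IccExtend_of_mem _ _ hs
  have h := ((hgc.integral_hasStrictDerivAt 0 t).hasDerivAt).hasDerivWithinAt (s := Icc 0 1)
  rw [hgf t ht] at h
  have e : ∀ u ∈ Icc (0 : ℝ) 1, ∫ s in (0 : ℝ)..u, f s = ∫ s in (0 : ℝ)..u, g s := by
    intro u hu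
    apply intervalIntegral.integral_congr
    intro s hs
    rw [uIcc_of_le hu.1] at hs
    exact (hgf s ⟨hs.1, hs.2.trans hu.2⟩).symm
  exact h.congr e (e t ht)

lemma continuousOn_primitive {Y : Type*} [NormedAddCommGroup Y] [NormedSpace ℝ Y]
    [CompleteSpace Y] {f : ℝ → Y} (hf : ContinuousOn f (Icc 0 1)) :
    ContinuousOn (fun t => ∫ s in (0 : ℝ)..t, f s) (Icc 0 1) := fun _ ht =>
  (hasDerivWithinAt_primitive hf ht).continuousWithinAt

lemma eq_add_primitive_of_hasDerivWithinAt {Y : Type*} [NormedAddCommGroup Y] [NormedSpace ℝ Y]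
    [CompleteSpace Y] {f f' : ℝ → Y}
    (hf : ∀ t ∈ Icc (0 : ℝ) 1, HasDerivWithinAt f (f' t) (Icc 0 1) t)
    (hf' : ContinuousOn f' (Icc 0 1)) {t : ℝ} (ht : t ∈ Icc (0 : ℝ) 1) :
    f t = f 0 + ∫ s in (0 : ℝ)..t, f' s := by
  have := intervalIntegral.integral_eq_sub_of_hasDerivAt_of_le (a := 0) (b := t) (f := f)
    (f' := f') ht.1
    (fun s hs => (hf s ⟨hs.1, hs.2.trans ht.2⟩).continuousWithinAt.mono (Icc_subset_Icc_right ht.2))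
    (fun s hs => (hf s ⟨hs.1.le, hs.2.le.trans ht.2⟩).hasDerivAt
      (Icc_mem_nhds hs.1 (hs.2.trans_le ht.2)))
    (intervalIntegrable_of_continuousOn hf' ht)
  rw [this]
  abel

/-- The fundamental lemma of du Bois-Reymond for continuous functions. -/
lemma eq_add_primitive_of_test {α β : ℝ → ℝ} (hα : ContinuousOn α (Icc 0 1))
    (hβ : ContinuousOn β (Icc 0 1))
    (h : ∀ ψ, IsTest ψ → ∫ t in (0 : ℝ)..1, (deriv ψ t * α t + ψ t * β t) = 0)
    {t : ℝ} (ht : t ∈ Icc (0 : ℝ) 1) : α t = α 0 + ∫ s in (0 : ℝ)..t, β s := by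
  have hm := memLp_of_continuousOn hβ
  have hw : IsWeakDeriv 1 α (hm.toLp β : L2) := by
    refine IsWeakDeriv.congr ?_ hm.coeFn_toLp.symm
    intro ψ hψ
    have e := h ψ hψ
    rw [← integral_μI, integral_add] at e
    · rw [iteratedDeriv_one]
      simp only [mul_comm (α _), mul_comm (β _)]
      linarith
    · simpa only [mul_comm] using integrable_mul_test (memLp_of_continuousOn hα) hψ.deriv
    · simpa only [mul_comm] using integrable_mul_test hm hψ
  obtain ⟨c, hc⟩ := hw.eq_const_add (memLp_of_continuousOn hα)
  have e := eqOn_Icc_of_ae_eq hα (continuousOn_const.add (ext_continuous _).continuousOn) hc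
  have e1 : ∀ t ∈ Icc (0 : ℝ) 1, α t = c + ∫ s in (0 : ℝ)..t, β s := by
    intro t ht
    refine (e ht).trans ?_
    change c + ext (V (hm.toLp β)) t = _
    rw [ext_V _ ht, integral_congr_μI hm.coeFn_toLp ht]
  have e0 := e1 0 (by simp)
  rw [intervalIntegral.integral_same] at e0
  rw [e1 t ht, e0, add_zero]

/-! ### The Euler-Lagrange equation -/

/-- Variations ψ(t) g with a scalar test function ψ reduce the first variation to du Bois-Reymond's
lemma in time. -/
lemma IsGeodesic.momentum_apply_eq {γ : ℝ → H02} (hγ : IsGeodesic γ) (g : H02) {t : ℝ}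
    (ht : t ∈ Icc (0 : ℝ) 1) :
    momentum (D (γ t)) (D (velocity γ t)) (D g) =
      momentum (D (γ 0)) (D (velocity γ 0)) (D g) +
        ∫ s in (0 : ℝ)..t, -force (D (γ s)) (D (velocity γ s)) (D g) := by
  have hF := hγ.continuousOn_D
  have hX := hγ.continuousOn_D_velocity
  have hu := fun t ht => hγ.isUnit (t := t) ht
  refine eq_add_primitive_of_test
    (α := fun t => momentum (D (γ t)) (D (velocity γ t)) (D g))
    (β := fun t => -force (D (γ t)) (D (velocity γ t)) (D g))
    ((momentum_continuousOn hF hX hu).clm_apply continuousOn_const)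
    ((force_continuousOn hF hX hu).clm_apply continuousOn_const).neg ?_ ht
  intro ψ hψ
  have h := hγ.integral_dDensity (h := fun t => ψ t • g) (hψ.smooth.smul contDiff_const)
    (by simp [hψ.endpoints_eq_zero.1]) (by simp [hψ.endpoints_eq_zero.2])
  have hd : deriv (fun t => ψ t • g) = fun t => deriv ψ t • g := by
    funext t
    exact ((hψ.smooth.differentiable (by simp) t).hasDerivAt.smul_const g).deriv
  simp only [hd, dDensity_eq, map_smul, intervalIntegral.integral_const_mul] at h
  have h2 := (mul_eq_zero.1 h).resolve_left two_ne_zero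
  rw [← h2]
  congr 1
  funext t
  simp only [smul_eq_mul]
  ring

/-- The momentum is differentiable in time, as a functional on `H_0^2([0,1])`. -/
lemma IsGeodesic.momentum_hasDerivWithinAt {γ : ℝ → H02} (hγ : IsGeodesic γ) {t : ℝ}
    (ht : t ∈ Icc (0 : ℝ) 1) :
    HasDerivWithinAt
      (fun t => (momentum (D (γ t)) (D (velocity γ t))).comp D.toContinuousLinearMap)
      (-(force (D (γ t)) (D (velocity γ t))).comp D.toContinuousLinearMap) (Icc 0 1) t := by
  -- Since the force is norm continuous, its integral exists in the dual space; the scalar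
  -- identities for each fixed g then combine into one identity of functionals, which is
  -- differentiable in norm.
  have hN : ContinuousOn
      (fun t => -(force (D (γ t)) (D (velocity γ t))).comp D.toContinuousLinearMap) (Icc 0 1) :=
    ((force_continuousOn hγ.continuousOn_D hγ.continuousOn_D_velocity
      fun t ht => hγ.isUnit ht).clm_comp continuousOn_const).neg
  have h := (hasDerivWithinAt_primitive hN ht).const_add
    ((momentum (D (γ 0)) (D (velocity γ 0))).comp D.toContinuousLinearMap)
  have e : ∀ t ∈ Icc (0 : ℝ) 1,
      (momentum (D (γ t)) (D (velocity γ t))).comp D.toContinuousLinearMap =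
      (momentum (D (γ 0)) (D (velocity γ 0))).comp D.toContinuousLinearMap +
      ∫ s in (0 : ℝ)..t,
        -(force (D (γ s)) (D (velocity γ s))).comp D.toContinuousLinearMap := by
    intro t ht
    ext g
    rw [add_apply, ContinuousLinearMap.intervalIntegral_apply
      (intervalIntegrable_of_continuousOn hN ht)]
    exact hγ.momentum_apply_eq g ht
  exact h.congr e (e t ht)

/-! ### Test fields that move with the flow -/

/-- The derivative of a normalised bump. It corrects the boundary value at 1 of a test field without
disturbing its first derivative there. -/
lemma exists_bump_L2 : ∃ b : L2, V b pt1 = 0 ∧ V (ι (V b)) pt1 = 1 := by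
  obtain ⟨ρ, hρ, hρ1⟩ := exists_bump
  have hV : ∀ x ∈ Icc (0 : ℝ) 1, ext (V (hρ.deriv.memLp.toLp _)) x = ρ x := by
    intro x hx
    rw [ext_V _ hx, integral_congr_μI hρ.deriv.memLp.coeFn_toLp hx,
      intervalIntegral.integral_deriv_eq_sub (fun x _ => hρ.smooth.differentiable (by simp) x)
      (hρ.deriv.smooth.continuous.intervalIntegrable _ _), hρ.endpoints_eq_zero.1, sub_zero]
  refine ⟨hρ.deriv.memLp.toLp _, ?_, ?_⟩
  · have h1 := hV 1 (right_mem_Icc.2 zero_le_one)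
    rw [ext_of_mem _ (right_mem_Icc.2 zero_le_one), hρ.endpoints_eq_zero.2] at h1
    exact h1
  · refine (V_ι_apply _ _).trans (Eq.trans ?_ hρ1)
    apply intervalIntegral.integral_congr
    intro x hx
    have hx' : x ∈ uIcc (0 : ℝ) 1 := hx
    rw [uIcc_of_le zero_le_one] at hx'
    exact hV x hx'

lemma V_E_smul_add (F κ : L2) : V (E F • κ + V κ • F) = E F * V κ := by
  rw [E, add_smul, one_smul, map_add, map_add, add_mul, one_mul, mul_comm (V F), V_mul_V]
  abel

/-- A field with x-derivative φ_x · `V κ` has quotient `V κ` by φ_x, whose derivative is κ. This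
inverts `zf F` explicitly and isolates `wf` in the momentum. -/
lemma zf_E_smul_add {F : L2} (h : IsUnit (E F)) (κ : L2) : zf F (E F • κ + V κ • F) = κ := by
  have e : E F * V κ * R F ^ 2 = R F * V κ * (R F * E F) := by ring
  rw [zf, V_E_smul_add, e, smul_add, smul_smul, smul_smul, R_mul_E h, one_smul, mul_one]
  abel

/-- The argument is the time derivative of the preceding test field when F moves with velocity X. -/
lemma zf_V_smul_add (F X κ : L2) :
    zf F (V X • κ + V κ • X) = (V X * R F) • κ + V κ • zf F X := by
  have e : V (V X • κ + V κ • X) = V X * V κ := by rw [V_mul_V, map_add, add_comm]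
  rw [zf, zf, e]
  module

/-- `D` is an isometry, so the remainder has the same norm before and after applying it. -/
lemma hasDerivWithinAt_of_D {g : ℝ → H02} {g' : H02} {S : Set ℝ} {t : ℝ}
    (h : HasDerivWithinAt (fun t => D (g t)) (D g') S t) : HasDerivWithinAt g g' S t := by
  rw [hasDerivWithinAt_iff_isLittleO] at h ⊢
  refine (Asymptotics.isLittleO_norm_left.1 ?_)
  refine (Asymptotics.isLittleO_norm_left.2 h).congr_left fun s => ?_
  rw [← map_sub, ← map_smul, ← map_sub, D.norm_map]

/-- Integration by parts, with the boundary term at 1 killed by the mean-zero condition. A factor `V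
κ` is traded for κ paired with a continuous function; this is the gain of regularity in the
Euler-Lagrange equation. -/
lemma inner_V_smul {u v κ : L2} (hκ : V κ pt1 = 0) :
    inner ℝ u (V κ • v) = -inner ℝ (ι (B u v)) κ := by
  have h := congrArg (fun c : CI => c pt1) (B_mul_V u v κ)
  simp only [ContinuousMap.mul_apply, ContinuousMap.add_apply, hκ, mul_zero] at h
  rw [← B_pt1, ← B_pt1, ← V_smul_eq_B]
  linarith

lemma inner_one (u : L2) : inner ℝ one u = V u pt1 := by rw [← B_pt1]; rfl

lemma V_ι_mul_V_pt1 (c : CI) {κ : L2} (hκ : V κ pt1 = 0) :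
    V (ι (c * V κ)) pt1 = -inner ℝ (ι (V (ι c))) κ := by
  have e : ι (c * V κ) = V κ • ι c := by rw [ι_apply, ι_apply, smul_smul, mul_comm]
  rw [e, ← inner_one, inner_V_smul hκ]
  rfl

lemma inner_one_one : inner ℝ one one = (1 : ℝ) := by
  rw [inner_one, V_apply, integral_congr_μI coeFn_one pt1.2]
  simp [pt1]

lemma eq_smul_one_of_inner_eq_zero {v : L2} (h : ∀ κ : L2, V κ pt1 = 0 → inner ℝ v κ = (0 : ℝ)) :
    v = (inner ℝ one v : ℝ) • one := by
  set κ := v - (inner ℝ one v : ℝ) • one with hκ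
  have h1 : V κ pt1 = 0 := by
    rw [← inner_one, hκ, inner_sub_right, inner_smul_right, inner_one_one]
    ring
  have h2 : inner ℝ κ κ = (0 : ℝ) := by
    rw [show inner ℝ κ κ = inner ℝ (v - (inner ℝ one v : ℝ) • one) κ from rfl, inner_sub_left,
      h κ h1, inner_smul_left, inner_one κ, h1]
    simp
  exact sub_eq_zero.1 (inner_self_eq_zero.1 h2)


/-- The Euler-Lagrange equation, tested with a function of mean zero. -/
lemma IsGeodesic.inner_wf_eq {γ : ℝ → H02} (hγ : IsGeodesic γ) {b κ : L2}
    (hb : V b pt1 = 0) (hb1 : V (ι (V b)) pt1 = 1) (hκ : V κ pt1 = 0) {t : ℝ}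
    (ht : t ∈ Icc (0 : ℝ) 1) :
    HasDerivWithinAt (fun t => inner ℝ (wf (D (γ t)) (D (velocity γ t)) +
        (inner ℝ (wf (D (γ t)) (D (velocity γ t))) (zf (D (γ t)) b) : ℝ) •
          ι (V (ι (E (D (γ t)))))) κ)
      (inner ℝ (ι ((1 / 2 : ℝ) • B (wf (D (γ t)) (D (velocity γ t)))
          (zf (D (γ t)) (D (velocity γ t))) +
        (inner ℝ (wf (D (γ t)) (D (velocity γ t))) (zf (D (γ t)) b) : ℝ) •
          V (ι (V (D (velocity γ t)))) -
        (inner ℝ (wf (D (γ t)) (D (velocity γ t)))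
            ((V (D (velocity γ t)) * R (D (γ t))) • zf (D (γ t)) b) +
          3 / 2 * inner ℝ (wf (D (γ t)) (D (velocity γ t)))
            (V b • wf (D (γ t)) (D (velocity γ t))) : ℝ) • V (ι (E (D (γ t)))))) κ)
      (Icc 0 1) t := by
  set F : ℝ → L2 := fun t => D (γ t) with hF
  set X : ℝ → L2 := fun t => D (velocity γ t) with hX
  -- The value at 1 of the uncorrected field. Subtracting c · b makes the field vanish at 1, while
  -- its first derivative vanishes there because κ and b have mean zero.
  set c : ℝ → ℝ := fun t => V (ι (E (F t) * V κ)) pt1 with hc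
  set c' : ℝ → ℝ := fun t => V (ι (V (X t) * V κ)) pt1 with hc'
  have hFd := fun t ht => hγ.hasDerivWithinAt_D (t := t) ht
  have hg : ∀ t, ∃ g : H02, D g = E (F t) • κ + V κ • F t - c t • b := by
    intro t
    apply exists_D_eq
    · rw [map_sub, V_E_smul_add, map_smul]
      simp [hκ, hb]
    · rw [map_sub, V_E_smul_add, map_smul, map_sub, map_sub, map_smul, map_smul]
      simp [hb1, hc]
  have hg' : ∀ t, ∃ g : H02, D g = V (X t) • κ + V κ • X t - c' t • b := by
    intro t
    have e : V (V (X t) • κ + V κ • X t) = V (X t) * V κ := by rw [V_mul_V, map_add, add_comm]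
    apply exists_D_eq
    · rw [map_sub, e, map_smul]
      simp [hκ, hb]
    · rw [map_sub, e, map_smul, map_sub, map_sub, map_smul, map_smul]
      simp [hb1, hc']
  choose g hg using hg
  choose g' hg' using hg'
  have hcd : HasDerivWithinAt c (c' t) (Icc 0 1) t := by
    have h1 := (E_hasDerivWithinAt (hFd t ht)).mul_const (V κ)
    exact (((ContinuousMap.evalCLM ℝ pt1).comp (V.comp ι)).hasFDerivAt).comp_hasDerivWithinAt t h1
  have hgd : HasDerivWithinAt g (g' t) (Icc 0 1) t := by
    apply hasDerivWithinAt_of_D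
    have h1 := (E_hasDerivWithinAt (hFd t ht)).smul (hasDerivWithinAt_const t (Icc 0 1) κ)
    have h2 := (hFd t ht).const_smul (V κ)
    have h3 := (h1.add h2).sub (hcd.smul_const b)
    rw [hg']
    simp only [hg]
    refine HasDerivWithinAt.congr_deriv h3 ?_
    simp [hX]
  -- Product rule for the pairing of the moving functional with the moving field.
  have hM := (hγ.momentum_hasDerivWithinAt ht).clm_apply hgd
  have hz1 : ∀ t ∈ Icc (0 : ℝ) 1, zf (F t) (D (g t)) = κ - c t • zf (F t) b := by
    intro t ht
    have hu : IsUnit (E (F t)) := hγ.isUnit ht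
    rw [hg, ← zfL_apply, map_sub, map_smul, zfL_apply, zfL_apply, zf_E_smul_add hu]
  have hval : ∀ t ∈ Icc (0 : ℝ) 1,
      inner ℝ (wf (F t) (X t) + (inner ℝ (wf (F t) (X t)) (zf (F t) b) : ℝ) •
          ι (V (ι (E (F t))))) κ = momentum (F t) (X t) (D (g t)) := by
    intro t ht
    rw [momentum_apply, hz1 t ht, inner_sub_right, inner_smul_right, inner_add_left, inner_smul_left, hc]
    simp only [V_ι_mul_V_pt1 _ hκ]
    simp
    ring
  refine (hM.congr hval (hval t ht)).congr_deriv ?_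
  have hu : IsUnit (E (F t)) := hγ.isUnit ht
  change -force (F t) (X t) (D (g t)) + momentum (F t) (X t) (D (g' t)) = _
  -- The term (V X · R) κ appears here and, with opposite sign, in the force applied to g, so it
  -- drops out. The terms in V κ combine with coefficient 1 - 3/2 = -1/2, and integration by parts
  -- gives the +1/2 in front of `B`.
  have hz2 : zf (F t) (D (g' t)) = (V (X t) * R (F t)) • κ + V κ • zf (F t) (X t) -
      c' t • zf (F t) b := by
    rw [hg', ← zfL_apply, map_sub, map_smul, zfL_apply, zfL_apply, zf_V_smul_add]
  have hVg : V (D (g t)) • wf (F t) (X t) = V κ • zf (F t) (X t) - c t • V b • wf (F t) (X t) := by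
    rw [hg, map_sub, V_E_smul_add, map_smul, ← E_smul_wf hu, sub_smul, mul_comm, mul_smul,
      smul_assoc]
  have hcv : c t = -inner ℝ (ι (V (ι (E (F t))))) κ := V_ι_mul_V_pt1 _ hκ
  have hcv' : c' t = -inner ℝ (ι (V (ι (V (X t))))) κ := V_ι_mul_V_pt1 _ hκ
  have hq : (V (X t) * R (F t)) • (κ - c t • zf (F t) b) =
      (V (X t) * R (F t)) • κ - c t • (V (X t) * R (F t)) • zf (F t) b := by
    rw [smul_sub, smul_comm]
  rw [momentum_apply, force_apply, hz1 t ht, hz2, hVg, hq]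
  simp only [inner_sub_right, inner_add_right, inner_smul_right, map_sub, map_add, map_smul,
    inner_sub_left, inner_add_left, inner_smul_left, inner_V_smul hκ, hcv, hcv']
  simp
  ring

/-- The Euler-Lagrange equation: up to a continuous function, `u_xx ∘ φ` does not depend on
time. -/
lemma IsGeodesic.exists_wf_eq {γ : ℝ → H02} (hγ : IsGeodesic γ) :
    ∃ (T : ℝ → CI) (η r a : ℝ → ℝ), ContinuousOn T (Icc 0 1) ∧ ContinuousOn η (Icc 0 1) ∧
      ContinuousOn r (Icc 0 1) ∧ ContinuousOn a (Icc 0 1) ∧ ∀ t ∈ Icc (0 : ℝ) 1,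
        wf (D (γ t)) (D (velocity γ t)) = wf (D (γ 0)) (D (velocity γ 0)) + ι (T t) ∧
        T t = (∫ s in (0 : ℝ)..t, ((1 / 2 : ℝ) • B (wf (D (γ s)) (D (velocity γ s)))
            (zf (D (γ s)) (D (velocity γ s))) + η s • V (ι (V (D (velocity γ s)))) -
            r s • V (ι (E (D (γ s)))))) - η t • V (ι (E (D (γ t)))) + η 0 • V (ι (E (D (γ 0)))) +
          a t • 1 := by
  obtain ⟨b, hb, hb1⟩ := exists_bump_L2
  have hF := hγ.continuousOn_D
  have hX := hγ.continuousOn_D_velocity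
  have hu := fun t ht => hγ.isUnit (t := t) ht
  have hw := wf_continuousOn hF hX hu
  have hz := zf_continuousOn hF hX hu
  have hzb := zf_continuousOn hF (continuousOn_const (c := b)) hu
  have hR := R_continuousOn hF hu
  have hE : ContinuousOn (fun t => E (D (γ t))) (Icc 0 1) := by unfold E; fun_prop
  set η : ℝ → ℝ := fun t => inner ℝ (wf (D (γ t)) (D (velocity γ t))) (zf (D (γ t)) b) with hη
  set r : ℝ → ℝ := fun t => inner ℝ (wf (D (γ t)) (D (velocity γ t)))
            ((V (D (velocity γ t)) * R (D (γ t))) • zf (D (γ t)) b) +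
          3 / 2 * inner ℝ (wf (D (γ t)) (D (velocity γ t)))
            (V b • wf (D (γ t)) (D (velocity γ t))) with hr
  have hηc : ContinuousOn η (Icc 0 1) := hw.inner hzb
  have hrc : ContinuousOn r (Icc 0 1) := by fun_prop
  set σ : ℝ → CI := fun s => (1 / 2 : ℝ) • B (wf (D (γ s)) (D (velocity γ s)))
            (zf (D (γ s)) (D (velocity γ s))) + η s • V (ι (V (D (velocity γ s)))) -
            r s • V (ι (E (D (γ s)))) with hσ
  have hBc : ContinuousOn (fun s => B (wf (D (γ s)) (D (velocity γ s)))
            (zf (D (γ s)) (D (velocity γ s)))) (Icc 0 1) :=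
    (B.continuous.comp_continuousOn hw).clm_apply hz
  have hσc : ContinuousOn σ (Icc 0 1) := by fun_prop
  set S : ℝ → CI := fun t => (∫ s in (0 : ℝ)..t, σ s) - η t • V (ι (E (D (γ t)))) +
    η 0 • V (ι (E (D (γ 0)))) with hS
  have hSc : ContinuousOn S (Icc 0 1) := by
    have := continuousOn_primitive hσc
    fun_prop
  set d : ℝ → L2 := fun t => wf (D (γ t)) (D (velocity γ t)) - wf (D (γ 0)) (D (velocity γ 0)) -
    ι (S t) with hd
  have hdc : ContinuousOn d (Icc 0 1) := by fun_prop
  -- Test functions of mean zero determine `wf` only up to a constant in x; its value a(t) is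
  -- absorbed into T.
  set a : ℝ → ℝ := fun t => inner ℝ one (d t) with ha
  have hac : ContinuousOn a (Icc 0 1) := continuousOn_const.inner hdc
  have key : ∀ t ∈ Icc (0 : ℝ) 1, d t = a t • one := by
    intro t ht
    apply eq_smul_one_of_inner_eq_zero
    intro κ hκ
    have hsc : ContinuousOn (fun s => inner ℝ (ι (σ s)) κ) (Icc (0 : ℝ) 1) := by fun_prop
    have h := eq_add_primitive_of_hasDerivWithinAt
      (fun t ht => hγ.inner_wf_eq hb hb1 hκ (t := t) ht) hsc ht
    have hi : ∫ s in (0 : ℝ)..t, inner ℝ (ι (σ s)) κ =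
        inner ℝ (ι (∫ s in (0 : ℝ)..t, σ s)) κ :=
      ContinuousLinearMap.intervalIntegral_comp_comm (((innerSL ℝ).flip κ).comp ι)
        (intervalIntegrable_of_continuousOn hσc ht)
    rw [hi] at h
    simp only [hd, hS, map_sub, map_add, map_smul, inner_sub_left, inner_add_left,
      inner_smul_left] at h ⊢
    simp at h ⊢
    linarith
  refine ⟨fun t => S t + a t • 1, η, r, a, hSc.add (hac.smul continuousOn_const), hηc, hrc, hac,
    fun t ht => ⟨?_, rfl⟩⟩
  have h := key t ht
  have h1 : ι (1 : CI) = one := by rw [ι_apply, one_smul]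
  change _ = _ + ι (S t + a t • 1)
  have h2 := sub_eq_iff_eq_add.1 (sub_eq_iff_eq_add.1 h)
  rw [map_add, map_smul, h1, h2, add_comm, add_comm (a t • one)]


/-! ### Exchanging space and time -/

/-- The primitive vanishing at `0` of a continuous function. -/
def J : CI →L[ℝ] CI := V.comp ι

lemma J_apply (c : CI) (y : Icc (0 : ℝ) 1) : J c y = ∫ x in (0 : ℝ)..y, ext c x := V_ι_apply c y

/-- `s` is the map of two variables `c` with the order of the variables exchanged. -/
def IsSwap (c s : ℝ → CI) : Prop := ∀ (x : ℝ) (t : Icc (0 : ℝ) 1), s x t = ext (c t) x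

/-- A continuous curve of continuous functions is jointly continuous in both variables, and currying
in the other order gives a continuous curve again. -/
lemma exists_isSwap {c : ℝ → CI} (hc : ContinuousOn c (Icc 0 1)) :
    ∃ s, Continuous s ∧ IsSwap c s := by
  have hc' : Continuous fun t : Icc (0 : ℝ) 1 => c t :=
    continuousOn_iff_continuous_domRestrict.1 hc
  have h : Continuous fun p : ℝ × Icc (0 : ℝ) 1 => ext (c p.2) p.1 := by
    have h1 : Continuous fun p : ℝ × Icc (0 : ℝ) 1 => c p.2 := hc'.comp continuous_snd
    have h2 : Continuous fun p : ℝ × Icc (0 : ℝ) 1 => projIcc (0 : ℝ) 1 zero_le_one p.1 :=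
      continuous_projIcc.comp continuous_fst
    exact h1.eval h2
  exact ⟨ContinuousMap.curry ⟨_, h⟩, ContinuousMap.continuous _, fun x t => rfl⟩

lemma IsSwap.mul {c d s u : ℝ → CI} (hc : IsSwap c s) (hd : IsSwap d u) :
    IsSwap (fun t => c t * d t) (fun x => s x * u x) := fun x t => by
  rw [ContinuousMap.mul_apply, hc, hd]
  rfl

lemma IsSwap.add {c d s u : ℝ → CI} (hc : IsSwap c s) (hd : IsSwap d u) :
    IsSwap (fun t => c t + d t) (fun x => s x + u x) := fun x t => by
  rw [ContinuousMap.add_apply, hc, hd]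
  rfl

lemma IsSwap.sub {c d s u : ℝ → CI} (hc : IsSwap c s) (hd : IsSwap d u) :
    IsSwap (fun t => c t - d t) (fun x => s x - u x) := fun x t => by
  rw [ContinuousMap.sub_apply, hc, hd]
  rfl

lemma IsSwap.const_smul {c s : ℝ → CI} (hc : IsSwap c s) (k : ℝ) :
    IsSwap (fun t => k • c t) (fun x => k • s x) := fun x t => by
  rw [ContinuousMap.smul_apply, hc]
  rfl

lemma IsSwap.smul {c s : ℝ → CI} (hc : IsSwap c s) {η : ℝ → ℝ} {η' : CI}
    (hη : ∀ t : Icc (0 : ℝ) 1, η' t = η t) :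
    IsSwap (fun t => η t • c t) (fun x => η' * s x) := fun x t => by
  rw [ContinuousMap.mul_apply, hc, hη]
  rfl

lemma isSwap_const (c : CI) : IsSwap (fun _ => c) (fun x => ext c x • 1) := fun x t => by
  simp

/-- Integration of the curve in time becomes the operator `J` on values. Thus `J` integrates in x
before the exchange and in t after it. -/
lemma IsSwap.primitive {c s : ℝ → CI} (hc : IsSwap c s) (hcc : ContinuousOn c (Icc 0 1)) :
    IsSwap (fun t => ∫ u in (0 : ℝ)..t, c u) (fun x => J (s x)) := fun x t => by
  have h : ∫ u in (0 : ℝ)..t, ext (c u) x = ext (∫ u in (0 : ℝ)..t, c u) x :=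
    ContinuousLinearMap.intervalIntegral_comp_comm
      (ContinuousMap.evalCLM ℝ (projIcc (0 : ℝ) 1 zero_le_one x))
      (intervalIntegrable_of_continuousOn hcc t.2)
  rw [J_apply, ← h]
  apply intervalIntegral.integral_congr
  intro u hu
  rw [uIcc_of_le t.2.1] at hu
  have hu' : u ∈ Icc (0 : ℝ) 1 := ⟨hu.1, hu.2.trans t.2.2⟩
  simp only [ext_of_mem (s x) hu']
  exact hc x ⟨u, hu'⟩

/-- For each fixed t the relation is a primitive in x. Continuity of the swapped integrand into the
sup norm upgrades this to differentiability of a Banach-valued function; the part k(t), constant in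
x, disappears. -/
lemma IsSwap.hasDerivWithinAt {c d s u : ℝ → CI} (hc : IsSwap c s) (hd : IsSwap d u)
    (hu : Continuous u) {k : ℝ → ℝ} (h : ∀ t ∈ Icc (0 : ℝ) 1, c t = k t • 1 + J (d t))
    {x : ℝ} (hx : x ∈ Icc (0 : ℝ) 1) : HasDerivWithinAt s (u x) (Icc 0 1) x := by
  have e : ∀ x ∈ Icc (0 : ℝ) 1, s x = s 0 + ∫ y in (0 : ℝ)..x, u y := by
    intro x hx
    ext t
    have h1 : ∫ y in (0 : ℝ)..x, u y t = (∫ y in (0 : ℝ)..x, u y) t :=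
      ContinuousLinearMap.intervalIntegral_comp_comm (ContinuousMap.evalCLM ℝ t)
        (hu.intervalIntegrable _ _)
    have h2 : ∀ y ∈ Icc (0 : ℝ) 1, s y t = k t + ∫ v in (0 : ℝ)..y, u v t := by
      intro y hy
      rw [hc, h t t.2, ext_of_mem _ hy, ContinuousMap.add_apply, J_apply]
      simp [hd _ t]
    rw [ContinuousMap.add_apply, ← h1, h2 x hx, h2 0 (by simp)]
    simp
  have h3 := (hasDerivWithinAt_primitive hu.continuousOn hx).const_add (s 0)
  exact h3.congr e (e x hx)

/-- The time derivative of φ_xx / φ_x = ∂_x log φ_x is ∂_x(u_x ∘ φ), and the quotient vanishes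
initially because the curve starts at the identity. -/
lemma IsGeodesic.R_smul_eq {γ : ℝ → H02} (hγ : IsGeodesic γ) (h0 : γ 0 = 0) {t : ℝ}
    (ht : t ∈ Icc (0 : ℝ) 1) :
    R (D (γ t)) • D (γ t) = ∫ s in (0 : ℝ)..t, zf (D (γ s)) (D (velocity γ s)) := by
  have hz := zf_continuousOn hγ.continuousOn_D hγ.continuousOn_D_velocity fun t ht => hγ.isUnit ht
  have h := eq_add_primitive_of_hasDerivWithinAt (f := fun t => R (D (γ t)) • D (γ t))
    (f' := fun t => zf (D (γ t)) (D (velocity γ t))) (fun t ht => by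
      have hF := hγ.hasDerivWithinAt_D ht
      refine ((R_hasDerivWithinAt hF (hγ.isUnit ht)).smul hF).congr_deriv ?_
      rw [zf, neg_smul, sub_eq_add_neg]) hz ht
  simpa [h0] using h

lemma wf_zero (X : L2) : wf 0 X = X := by
  have hR : R 0 = 1 := by simp [R, E]
  rw [wf, zf, hR]
  simp

/-- The geodesic equation as an ordinary differential equation in the space variable, for
functions of time. -/
theorem IsGeodesic.exists_ode {γ : ℝ → H02} (hγ : IsGeodesic γ) (h0 : γ 0 = 0) {p : CI}
    (hp : R (D (γ 1)) • D (γ 1) = ι p) :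
    ∃ (e q τ : ℝ → CI) (η r v : CI) (z : Icc (0 : ℝ) 1), D (velocity γ 0) = ι v ∧
      (∀ x ∈ Icc (0 : ℝ) 1,
        HasDerivWithinAt e (e x * J (e x * (ext v x • 1 + τ x))) (Icc 0 1) x ∧
        HasDerivWithinAt q (e x * (ext v x • 1 + τ x)) (Icc 0 1) x ∧
        HasDerivWithinAt τ (J ((1 / 2 : ℝ) • ((ext v x • 1 + τ x) * (e x * (ext v x • 1 + τ x))) +
          η * (e x * q x) - r * e x) - η * e x + (η z * e x z) • 1) (Icc 0 1) x) ∧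
      ∀ x ∈ Icc (0 : ℝ) 1, J (e x) pt1 ≠ 0 ∧
        J (e x) pt1 * ext v x + J (e x * τ x) pt1 = ext p x := by
  obtain ⟨T, η, r, a, hT, hη, hr, ha, hw⟩ := hγ.exists_wf_eq
  have hF := hγ.continuousOn_D
  have hX := hγ.continuousOn_D_velocity
  have hu := fun t ht => hγ.isUnit (t := t) ht
  have hE : ContinuousOn (fun t => E (D (γ t))) (Icc 0 1) := by unfold E; fun_prop
  have h01 : (1 : ℝ) ∈ Icc (0 : ℝ) 1 := right_mem_Icc.2 zero_le_one
  have hw0 : wf (D (γ 0)) (D (velocity γ 0)) = D (velocity γ 0) := by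
    rw [h0, map_zero, wf_zero]
  obtain ⟨e, hec, he⟩ := exists_isSwap hE
  obtain ⟨τ, hτc, hτ⟩ := exists_isSwap hT
  have hz : ∀ t ∈ Icc (0 : ℝ) 1, zf (D (γ t)) (D (velocity γ t)) =
      E (D (γ t)) • D (velocity γ 0) + ι (E (D (γ t)) * T t) := by
    intro t ht
    rw [← E_smul_wf (hu t ht), (hw t ht).1, hw0, smul_add, ι_apply, ι_apply, smul_smul]
  have hpos : ∀ x ∈ Icc (0 : ℝ) 1, 0 < J (e x) pt1 := by
    intro x hx
    rw [J_apply]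
    apply intervalIntegral.intervalIntegral_pos_of_pos_on
      ((ext_continuous _).intervalIntegrable _ _) _ zero_lt_one
    intro t ht
    rw [ext_of_mem _ (Ioo_subset_Icc_self ht), he]
    exact pos_ext_E (hγ.mem t (Ioo_subset_Icc_self ht)) hx
  set β : CI := ∫ t in (0 : ℝ)..1, E (D (γ t)) with hβ
  set α : CI := ∫ t in (0 : ℝ)..1, E (D (γ t)) * T t with hα
  have hβx : ∀ x, ext β x = J (e x) pt1 := fun x => ((he.primitive hE) x pt1).symm
  have hαx : ∀ x, ext α x = J (e x * τ x) pt1 := fun x =>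
    (((he.mul hτ).primitive (hE.mul hT)) x pt1).symm
  have hβu : IsUnit β := by
    rw [ContinuousMap.isUnit_iff_forall_ne_zero]
    intro x
    rw [← ext_of_mem _ x.2, hβx]
    exact (hpos x x.2).ne'
  -- The formula for φ_xx / φ_x at time 1, with `zf` replaced by φ_x (X(0) + T). As X(0) does not
  -- depend on time, it comes out of the integral.
  have hint : ι p = β • D (velocity γ 0) + ι α := by
    rw [← hp, hγ.R_smul_eq h0 h01]
    have e1 : ∫ s in (0 : ℝ)..1, zf (D (γ s)) (D (velocity γ s)) =
        ∫ s in (0 : ℝ)..1, (E (D (γ s)) • D (velocity γ 0) + ι (E (D (γ s)) * T s)) := by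
      apply intervalIntegral.integral_congr
      intro t ht
      rw [uIcc_of_le zero_le_one] at ht
      exact hz t ht
    have c1 : ContinuousOn (fun s => E (D (γ s)) • D (velocity γ 0)) (Icc 0 1) := by fun_prop
    have c2 : ContinuousOn (fun s => ι (E (D (γ s)) * T s)) (Icc 0 1) := by fun_prop
    have e2 : ∫ s in (0 : ℝ)..1, E (D (γ s)) • D (velocity γ 0) = β • D (velocity γ 0) :=
      ContinuousLinearMap.intervalIntegral_comp_comm
        ((ContinuousLinearMap.lsmul ℝ CI).flip (D (velocity γ 0)))
        (intervalIntegrable_of_continuousOn hE h01)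
    have e3 : ∫ s in (0 : ℝ)..1, ι (E (D (γ s)) * T s) = ι α :=
      ContinuousLinearMap.intervalIntegral_comp_comm ι
        (intervalIntegrable_of_continuousOn (hE.mul hT) h01)
    rw [e1, intervalIntegral.integral_add (intervalIntegrable_of_continuousOn c1 h01)
      (intervalIntegrable_of_continuousOn c2 h01), e2, e3]
  -- β is positive on [0,1], so the endpoint relation can be solved for X(0), which turns out to be
  -- continuous.
  set v : CI := Ring.inverse β * (p - α) with hv
  have hX0 : D (velocity γ 0) = ι v := by
    have h1 : β • D (velocity γ 0) = ι (p - α) := by rw [map_sub, hint, add_sub_cancel_right]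
    have h2 : ι v = Ring.inverse β • ι (p - α) := by rw [hv, ι_apply, ι_apply, mul_smul]
    rw [h2, ← h1, smul_smul, Ring.inverse_mul_cancel _ hβu, one_smul]
  have hβv : ∀ x, ext β x * ext v x + ext α x = ext p x := by
    have h1 : β * v + α = p := by
      rw [hv, ← mul_assoc, Ring.mul_inverse_cancel _ hβu, one_mul, sub_add_cancel]
    exact fun x => congrFun (congrArg ext h1) x
  set W : ℝ → CI := fun t => v + T t with hW
  have hWc : ContinuousOn W (Icc 0 1) := by fun_prop
  have hWs : IsSwap W (fun x => ext v x • 1 + τ x) := (isSwap_const v).add hτ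
  have hvc : Continuous fun x => ext v x • (1 : CI) + τ x :=
    ((ext_continuous v).smul continuous_const).add hτc
  have hwW : ∀ t ∈ Icc (0 : ℝ) 1, wf (D (γ t)) (D (velocity γ t)) = ι (W t) := fun t ht => by
    rw [(hw t ht).1, hw0, hX0, ← map_add]
  have hzW : ∀ t ∈ Icc (0 : ℝ) 1, zf (D (γ t)) (D (velocity γ t)) = ι (E (D (γ t)) * W t) :=
    fun t ht => by
      rw [← E_smul_wf (hu t ht), hwW t ht, ι_apply, ι_apply, smul_smul]
  have hVX : ∀ t ∈ Icc (0 : ℝ) 1, V (D (velocity γ t)) =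
      E (D (γ t)) * J (E (D (γ t)) * W t) := fun t ht => by
    have h1 := V_zf (hu t ht) (D (velocity γ t))
    rw [hzW t ht] at h1
    have h2 : J (E (D (γ t)) * W t) = V (D (velocity γ t)) * R (D (γ t)) := h1
    rw [h2, mul_comm (V _), ← mul_assoc, E_mul_R (hu t ht), one_mul]
  -- φ_xx = φ_x ∫ φ_x W ds with W = u_xx ∘ φ; integrated in x, this is the equation for `e`.
  have hFW : ∀ t ∈ Icc (0 : ℝ) 1, D (γ t) =
      ι (E (D (γ t)) * ∫ s in (0 : ℝ)..t, E (D (γ s)) * W s) := fun t ht => by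
    have h1 := hγ.R_smul_eq h0 ht
    have h2 : ∫ s in (0 : ℝ)..t, zf (D (γ s)) (D (velocity γ s)) =
        ∫ s in (0 : ℝ)..t, ι (E (D (γ s)) * W s) := by
      apply intervalIntegral.integral_congr
      intro s hs
      rw [uIcc_of_le ht.1] at hs
      exact hzW s ⟨hs.1, hs.2.trans ht.2⟩
    have h3 : ∫ s in (0 : ℝ)..t, ι (E (D (γ s)) * W s) =
        ι (∫ s in (0 : ℝ)..t, E (D (γ s)) * W s) :=
      ContinuousLinearMap.intervalIntegral_comp_comm ι
        (intervalIntegrable_of_continuousOn (hE.mul hWc) ht)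
    rw [h2, h3] at h1
    rw [ι_apply, mul_smul, ← ι_apply, ← h1, smul_smul, E_mul_R (hu t ht), one_smul]
  have hQc : ContinuousOn (fun t => J (E (D (γ t)) * W t)) (Icc 0 1) :=
    J.continuous.comp_continuousOn (hE.mul hWc)
  obtain ⟨q, hqc, hq⟩ := exists_isSwap hQc
  have hηr : ∀ {f : ℝ → ℝ}, ContinuousOn f (Icc 0 1) → ∃ f' : CI, ∀ t, f' t = f t := fun hf =>
    ⟨⟨_, continuousOn_iff_continuous_domRestrict.1 hf⟩, fun t => rfl⟩
  obtain ⟨η', hη'⟩ := hηr hη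
  obtain ⟨r', hr'⟩ := hηr hr
  set z : Icc (0 : ℝ) 1 := ⟨0, left_mem_Icc.2 zero_le_one⟩ with hzdef
  set σ : ℝ → CI := fun s => (1 / 2 : ℝ) • (W s * (E (D (γ s)) * W s)) +
    η s • (E (D (γ s)) * J (E (D (γ s)) * W s)) - r s • E (D (γ s)) with hσ
  have hσc : ContinuousOn σ (Icc 0 1) := by fun_prop
  have hσs : IsSwap σ (fun x =>
      (1 / 2 : ℝ) • ((ext v x • 1 + τ x) * (e x * (ext v x • 1 + τ x))) +
          η' * (e x * q x) - r' * e x) :=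
    (((hWs.mul (he.mul hWs)).const_smul _).add ((he.mul hq).smul hη')).sub (he.smul hr')
  -- Every term of T except a(t) is a primitive in x, so pulling `J` out exposes ∂_x T.
  have hT2 : ∀ t ∈ Icc (0 : ℝ) 1, T t = a t • 1 + J ((∫ s in (0 : ℝ)..t, σ s) -
      η t • E (D (γ t)) + η 0 • E (D (γ 0))) := by
    intro t ht
    have h1 : ∫ s in (0 : ℝ)..t, ((1 / 2 : ℝ) • B (wf (D (γ s)) (D (velocity γ s)))
            (zf (D (γ s)) (D (velocity γ s))) + η s • V (ι (V (D (velocity γ s)))) -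
            r s • V (ι (E (D (γ s))))) = ∫ s in (0 : ℝ)..t, J (σ s) := by
      apply intervalIntegral.integral_congr
      intro s hs
      rw [uIcc_of_le ht.1] at hs
      have hs' : s ∈ Icc (0 : ℝ) 1 := ⟨hs.1, hs.2.trans ht.2⟩
      have h2 : B (ι (W s)) (ι (E (D (γ s)) * W s)) = J (W s * (E (D (γ s)) * W s)) := by
        rw [← V_smul_eq_B, ι_apply, smul_smul]
        rfl
      simp only [hσ]
      rw [hwW s hs', hzW s hs', hVX s hs', h2, map_sub, map_add, map_smul, map_smul, map_smul]
      rfl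
    have h2 : ∫ s in (0 : ℝ)..t, J (σ s) = J (∫ s in (0 : ℝ)..t, σ s) :=
      ContinuousLinearMap.intervalIntegral_comp_comm J (intervalIntegrable_of_continuousOn hσc ht)
    rw [(hw t ht).2, h1, h2, map_add, map_sub, map_smul, map_smul, add_comm]
    rfl
  have hη0 : IsSwap (fun _ => η 0 • E (D (γ 0))) (fun x => (η' z * e x z) • 1) := by
    intro x t
    change ((η' z * e x z) • (1 : CI)) t = η 0 * ext (E (D (γ 0))) x
    rw [hη' z, he x z, ContinuousMap.smul_apply, ContinuousMap.one_apply, smul_eq_mul, mul_one]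
  have hewc : Continuous fun x => e x * (ext v x • 1 + τ x) := hec.mul hvc
  refine ⟨e, q, τ, η', r', v, z, hX0, fun x hx => ⟨?_, ?_, ?_⟩, fun x hx => ⟨(hpos x hx).ne', ?_⟩⟩
  · refine he.hasDerivWithinAt (he.mul ((he.mul hWs).primitive (hE.mul hWc)))
      (hec.mul (J.continuous.comp hewc)) (k := fun _ => 1) (fun t ht => ?_) hx
    rw [one_smul]
    conv_lhs => rw [E, hFW t ht]
    rfl
  · exact hq.hasDerivWithinAt (he.mul hWs) hewc (k := fun _ => 0) (fun t ht => by simp) hx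
  · refine hτ.hasDerivWithinAt (((hσs.primitive hσc).sub (he.smul hη')).add hη0) ?_ hT2 hx
    have hevc : Continuous fun x => e x z := (ContinuousMap.evalCLM ℝ z).continuous.comp hec
    have := J.continuous
    fun_prop
  · rw [← hβx, ← hαx, hβv]


/-! ### Bootstrapping -/

lemma contDiffOn_succ_of_hasDerivWithinAt {Y : Type*} [NormedAddCommGroup Y] [NormedSpace ℝ Y]
    {f f' : ℝ → Y} {m : ℕ} (h : ∀ x ∈ Icc (0 : ℝ) 1, HasDerivWithinAt f (f' x) (Icc 0 1) x)
    (hf' : ContDiffOn ℝ m f' (Icc 0 1)) : ContDiffOn ℝ (m + 1 : ℕ) f (Icc 0 1) := by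
  push_cast
  rw [contDiffOn_succ_iff_derivWithin (uniqueDiffOn_Icc zero_lt_one)]
  refine ⟨fun x hx => (h x hx).differentiableWithinAt, by simp, hf'.congr fun x hx => ?_⟩
  exact (h x hx).derivWithin (uniqueDiffOn_Icc zero_lt_one x hx)

/-- Induction on the order j. The algebraic relation expresses v through p, e and τ at order j; the
right-hand sides are then C^j, since products, `J` and evaluations are bounded (bi)linear, and the
unknowns gain one order. The last step uses v at order m only, hence m + 1 in the conclusion. -/
lemma contDiffOn_of_ode {e q τ : ℝ → CI} {η r : CI} {v p : ℝ → ℝ} {z : Icc (0 : ℝ) 1} {m : ℕ}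
    (h : ∀ x ∈ Icc (0 : ℝ) 1,
        HasDerivWithinAt e (e x * J (e x * (v x • 1 + τ x))) (Icc 0 1) x ∧
        HasDerivWithinAt q (e x * (v x • 1 + τ x)) (Icc 0 1) x ∧
        HasDerivWithinAt τ (J ((1 / 2 : ℝ) • ((v x • 1 + τ x) * (e x * (v x • 1 + τ x))) +
          η * (e x * q x) - r * e x) - η * e x + (η z * e x z) • 1) (Icc 0 1) x)
    (hv : ∀ x ∈ Icc (0 : ℝ) 1, J (e x) pt1 ≠ 0 ∧ J (e x) pt1 * v x + J (e x * τ x) pt1 = p x)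
    (hp : ContDiffOn ℝ m p (Icc 0 1)) :
    ContDiffOn ℝ (m + 1 : ℕ) e (Icc 0 1) ∧ ContDiffOn ℝ (m + 1 : ℕ) τ (Icc 0 1) := by
  have ev : ∀ (k : WithTop ℕ∞) (y : Icc (0 : ℝ) 1) (f : ℝ → CI), ContDiffOn ℝ k f (Icc 0 1) →
      ContDiffOn ℝ k (fun x => f x y) (Icc 0 1) := fun k y f hf =>
    ContDiff.comp_contDiffOn (ContinuousMap.evalCLM ℝ y : CI →L[ℝ] ℝ).contDiff hf
  have hJ : ∀ (k : WithTop ℕ∞) (f : ℝ → CI), ContDiffOn ℝ k f (Icc 0 1) →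
      ContDiffOn ℝ k (fun x => J (f x)) (Icc 0 1) := fun k f hf => J.contDiff.comp_contDiffOn hf
  have hve : ∀ x ∈ Icc (0 : ℝ) 1, v x = (p x - J (e x * τ x) pt1) * (J (e x) pt1)⁻¹ := by
    intro x hx
    obtain ⟨h1, h2⟩ := hv x hx
    rw [← h2]
    field_simp
    ring
  suffices H : ∀ j : ℕ, j ≤ m + 1 → ContDiffOn ℝ j e (Icc 0 1) ∧ ContDiffOn ℝ j q (Icc 0 1) ∧
      ContDiffOn ℝ j τ (Icc 0 1) from ⟨(H _ le_rfl).1, (H _ le_rfl).2.2⟩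
  intro j
  induction j with
  | zero =>
    intro _
    simp only [Nat.cast_zero, contDiffOn_zero]
    exact ⟨fun x hx => (h x hx).1.continuousWithinAt, fun x hx => (h x hx).2.1.continuousWithinAt,
      fun x hx => (h x hx).2.2.continuousWithinAt⟩
  | succ j ih =>
    intro hj
    obtain ⟨he, hq, hτ⟩ := ih (by omega)
    have hpj : ContDiffOn ℝ j p (Icc 0 1) := hp.of_le (by exact_mod_cast (by omega : j ≤ m))
    have hvj : ContDiffOn ℝ j v (Icc 0 1) := by
      refine ContDiffOn.congr ?_ hve
      exact (hpj.sub (ev _ _ _ (hJ _ _ (he.mul hτ)))).mul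
        ((ev _ _ _ (hJ _ _ he)).inv fun x hx => (hv x hx).1)
    have hW : ContDiffOn ℝ j (fun x => v x • (1 : CI) + τ x) (Icc 0 1) :=
      (hvj.smul contDiffOn_const).add hτ
    have heW := he.mul hW
    refine ⟨contDiffOn_succ_of_hasDerivWithinAt (fun x hx => (h x hx).1) (he.mul (hJ _ _ heW)),
      contDiffOn_succ_of_hasDerivWithinAt (fun x hx => (h x hx).2.1) heW,
      contDiffOn_succ_of_hasDerivWithinAt (fun x hx => (h x hx).2.2) ?_⟩
    have h1 := (((hW.mul heW).const_smul (1 / 2 : ℝ)).add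
      ((contDiffOn_const (c := η)).mul (he.mul hq))).sub ((contDiffOn_const (c := r)).mul he)
    exact ((hJ _ _ h1).sub ((contDiffOn_const (c := η)).mul he)).add
      (((contDiffOn_const (c := η z)).mul (ev _ z _ he)).smul contDiffOn_const)

/-! ### Sobolev spaces as iterated primitives -/

/-- The Sobolev space `H^m`, described by iterated primitives. -/
def Hs : ℕ → (ℝ → ℝ) → Prop
  | 0, f => MemLp f 2 μI
  | m + 1, f => ∃ (c : ℝ) (g : L2), Hs m g ∧ f =ᵐ[μI] fun x => c + ext (V g) x

lemma Hs.congr {m : ℕ} {f g : ℝ → ℝ} (hf : Hs m f) (h : f =ᵐ[μI] g) : Hs m g := by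
  cases m with
  | zero => exact MemLp.ae_eq h hf
  | succ m =>
    obtain ⟨c, u, hu, hc⟩ := hf
    exact ⟨c, u, hu, h.symm.trans hc⟩

lemma Hs.memLp {m : ℕ} {f : ℝ → ℝ} (hf : Hs m f) : MemLp f 2 μI := by
  cases m with
  | zero => exact hf
  | succ m =>
    obtain ⟨c, u, hu, hc⟩ := hf
    exact ((memLp_const c).add (memLp_ext (V u))).ae_eq hc.symm

lemma Hs.of_succ {m : ℕ} {f : ℝ → ℝ} (hf : Hs (m + 1) f) : Hs m f := by
  induction m generalizing f with
  | zero => exact hf.memLp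
  | succ m ih =>
    obtain ⟨c, u, hu, hc⟩ := hf
    exact ⟨c, u, ih hu, hc⟩

lemma Hs.add {m : ℕ} {f g : ℝ → ℝ} (hf : Hs m f) (hg : Hs m g) : Hs m (fun x => f x + g x) := by
  induction m generalizing f g with
  | zero => exact MemLp.add hf hg
  | succ m ih =>
    obtain ⟨c, u, hu, hc⟩ := hf
    obtain ⟨c', u', hu', hc'⟩ := hg
    refine ⟨c + c', u + u', (ih hu hu').congr (Lp.coeFn_add u u').symm, ?_⟩
    filter_upwards [hc, hc'] with x h h'
    rw [h, h', map_add]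
    change _ = _ + (ext (V u) x + ext (V u') x)
    ring

lemma hs_const (m : ℕ) (c : ℝ) : Hs m (fun _ => c) := by
  induction m generalizing c with
  | zero => exact memLp_const c
  | succ m ih =>
    refine ⟨c, 0, (ih 0).congr (Lp.coeFn_zero ℝ 2 μI).symm, Filter.Eventually.of_forall fun x => ?_⟩
    rw [map_zero]
    exact (add_zero c).symm

lemma exists_CI_eq {c : ℝ → ℝ} (hc : ContinuousOn c (Icc 0 1)) :
    ∃ d : CI, ∀ x ∈ Icc (0 : ℝ) 1, ext d x = c x :=
  ⟨⟨_, continuousOn_iff_continuous_domRestrict.1 hc⟩, fun _ hx => ext_of_mem _ hx⟩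

lemma ae_of_forall_Icc {P : ℝ → Prop} (h : ∀ x ∈ Icc (0 : ℝ) 1, P x) : ∀ᵐ x ∂μI, P x := by
  filter_upwards [ae_restrict_mem measurableSet_Ioo] with x hx
  exact h x (Ioo_subset_Icc_self hx)

/-- Induction through (c f)' = c f' + c' f: in the first term f' has one Sobolev derivative fewer,
in the second c' has one classical derivative fewer. -/
lemma Hs.contDiffOn_mul {m : ℕ} {c f : ℝ → ℝ} (hc : ContDiffOn ℝ m c (Icc 0 1)) (hf : Hs m f) :
    Hs m (fun x => c x * f x) := by
  induction m generalizing c f with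
  | zero =>
    obtain ⟨d, hd⟩ := exists_CI_eq hc.continuousOn
    refine MemLp.ae_eq ?_ (ext_mul_memLp d (MemLp.toLp f hf))
    filter_upwards [MemLp.coeFn_toLp hf, ae_of_forall_Icc hd] with x h h'
    rw [h, h']
  | succ m ih =>
    have hf' := hf
    obtain ⟨a, g, hg, ha⟩ := hf
    have hc0 := hc
    push_cast at hc
    rw [contDiffOn_succ_iff_derivWithin (uniqueDiffOn_Icc zero_lt_one)] at hc
    obtain ⟨hd, -, hc'⟩ := hc
    set c' := derivWithin c (Icc 0 1) with hcdef
    have hm := memLp_of_continuousOn hc'.continuousOn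
    set u : L2 := hm.toLp c' with hu
    have hcu : ∀ x ∈ Icc (0 : ℝ) 1, c x = c 0 + ext (V u) x := by
      intro x hx
      rw [ext_V _ hx, integral_congr_μI hm.coeFn_toLp hx]
      exact eq_add_primitive_of_hasDerivWithinAt (fun x hx => (hd x hx).hasDerivWithinAt)
        hc'.continuousOn hx
    -- Constant term and derivative of the product (c(0) + V u)(a + V g).
    refine ⟨c 0 * a, c 0 • g + a • u + (V g • u + V u • g), ?_, ?_⟩
    · have h1 := (ih (hc0.of_le (by exact_mod_cast m.le_succ)) hg).add (ih hc' hf'.of_succ)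
      refine h1.congr ?_
      filter_upwards [ha, hm.coeFn_toLp, ae_of_forall_Icc hcu, coeFn_smulCI (V g) u,
        coeFn_smulCI (V u) g, Lp.coeFn_add (c 0 • g + a • u) (V g • u + V u • g),
        Lp.coeFn_add (c 0 • g) (a • u), Lp.coeFn_add (V g • u) (V u • g),
        Lp.coeFn_smul (c 0) g, Lp.coeFn_smul a u] with x h1 h2 h3 h4 h5 h6 h7 h8 h9 h10
      rw [h6, Pi.add_apply, h7, h8, Pi.add_apply, Pi.add_apply, h9, h10, h4, h5, h1, h2, h3]
      simp only [Pi.smul_apply, smul_eq_mul]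
      rw [h2]
      ring
    · filter_upwards [ha, ae_of_forall_Icc hcu] with x h1 h2
      have e : V (c 0 • g + a • u + (V g • u + V u • g)) = c 0 • V g + a • V u + V u * V g := by
        rw [V_mul_V, map_add, map_add, map_add, map_smul, map_smul]
      rw [e, h1, h2]
      change _ = c 0 * a + (c 0 * ext (V g) x + a * ext (V u) x + ext (V u) x * ext (V g) x)
      ring

lemma hs_of_contDiffOn {m : ℕ} {c : ℝ → ℝ} (hc : ContDiffOn ℝ m c (Icc 0 1)) : Hs m c := by
  simpa using (hs_const m 1).contDiffOn_mul hc

/-- The one-dimensional Sobolev embedding: each level of iterated primitives beyond the first yields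
one classical derivative. -/
lemma Hs.exists_contDiffOn {m : ℕ} {f : ℝ → ℝ} (hf : Hs (m + 1) f) :
    ∃ p, ContDiffOn ℝ m p (Icc 0 1) ∧ f =ᵐ[μI] p := by
  induction m generalizing f with
  | zero =>
    obtain ⟨c, g, -, hc⟩ := hf
    refine ⟨_, ?_, hc⟩
    simp only [Nat.cast_zero, contDiffOn_zero]
    exact continuousOn_const.add (ext_continuous _).continuousOn
  | succ m ih =>
    obtain ⟨c, g, hg, hc⟩ := hf
    obtain ⟨p, hp, hgp⟩ := ih hg
    refine ⟨fun x => c + ∫ y in (0 : ℝ)..x, p y, ?_, ?_⟩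
    · exact contDiffOn_succ_of_hasDerivWithinAt
        (fun x hx => (hasDerivWithinAt_primitive hp.continuousOn hx).const_add c) hp
    · refine hc.trans (ae_of_forall_Icc fun x hx => ?_)
      change c + ext (V g) x = c + ∫ y in (0 : ℝ)..x, p y
      rw [ext_V _ hx, integral_congr_μI hgp hx]

lemma MemH.hs {m : ℕ} {f : ℝ → ℝ} (hf : MemH m f) : Hs m f := by
  induction m generalizing f with
  | zero => exact hf.1
  | succ m ih =>
    obtain ⟨g, hg, hw⟩ := hf.2 1 (by omega)
    have hw' : IsWeakDeriv 1 f (hg.toLp g : L2) := hw.congr hg.coeFn_toLp.symm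
    obtain ⟨c, hc⟩ := hw'.eq_const_add hf.1
    refine ⟨c, hg.toLp g, ih ⟨Lp.memLp _, fun k hk => ?_⟩, hc⟩
    obtain ⟨g', hg', hw2⟩ := hf.2 (k + 1) (by omega)
    exact ⟨g', hg', hw'.of_succ hw2⟩

lemma Hs.memH {m : ℕ} {f : ℝ → ℝ} (hf : Hs m f) : MemH m f := by
  refine ⟨hf.memLp, fun k hk => ?_⟩
  induction m generalizing f k with
  | zero =>
    obtain rfl : k = 0 := by omega
    exact ⟨f, hf, isWeakDeriv_zero f⟩
  | succ m ih =>
    cases k with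
    | zero => exact ⟨f, hf.memLp, isWeakDeriv_zero f⟩
    | succ k =>
      obtain ⟨c, g, hg, hc⟩ := hf
      obtain ⟨g', hg', hw⟩ := ih hg k (by omega)
      have h1 : IsWeakDeriv 1 ((fun _ => c) + ext (V g)) (0 + g) :=
        IsWeakDeriv.add (memLp_const c) (memLp_ext _) MemLp.zero (Lp.memLp g)
          (isWeakDeriv_const c) (isWeakDeriv_V g)
      rw [zero_add] at h1
      exact ⟨g', hg', (h1.congr_left hc.symm).succ hw⟩

lemma H02.memH_D {m : ℕ} {f : H02} (hf : MemH (m + 2) f) : MemH m (D f) := by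
  refine ⟨Lp.memLp _, fun k hk => ?_⟩
  obtain ⟨g, hg, hw⟩ := hf.2 (k + 2) (by omega)
  exact ⟨g, hg, f.isWeakDeriv_two.of_succ (f.isWeakDeriv_one.of_succ hw)⟩

lemma H02.memH_of_D {m : ℕ} {f : H02} (hf : MemH m (D f)) : MemH (m + 2) f := by
  refine ⟨f.prop.1.1, fun k hk => ?_⟩
  by_cases hk2 : k ≤ 1
  · exact f.prop.1.2 k (by omega)
  · obtain ⟨j, rfl⟩ : ∃ j, k = j + 2 := ⟨k - 2, by omega⟩
    obtain ⟨g, hg, hw⟩ := hf.2 j (by omega)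
    exact ⟨g, hg, f.isWeakDeriv_one.succ (f.isWeakDeriv_two.succ hw)⟩

lemma toMap_injective : Function.Injective toMap := by
  intro f g h
  apply Subtype.ext
  funext x
  exact add_left_cancel (congrFun h x)

lemma MemH.of_toMap {n : ℕ} {f : H02} (hf : MemH n (toMap f)) : MemH n f := by
  have h1 : MemH n (fun x : ℝ => x) := (hs_of_contDiffOn contDiffOn_id).memH
  have h := hf.add (h1.smul (-1))
  have e : toMap f + (-1 : ℝ) • (fun x : ℝ => x) = (f : ℝ → ℝ) := by
    funext x
    simp [toMap]
  rwa [e] at h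


/-! ### Conclusion -/

/-- The initial velocity of a geodesic is as regular as its end point. -/
theorem IsGeodesic.memH_velocity_zero {n : ℕ} (hn : 3 ≤ n) {φ₁ : H02} (hφ₁ : φ₁ ∈ Diff02)
    (hreg : MemH n (toMap φ₁)) {γ : ℝ → H02} (hγ : IsGeodesic γ) (h0 : toMap (γ 0) = id)
    (h1 : toMap (γ 1) = toMap φ₁) : MemH n (velocity γ 0) := by
  -- Two derivatives go into `D`, and one more makes φ_1'' continuous; this is where n ≥ 3 enters.
  obtain ⟨m, rfl⟩ : ∃ m, n = m + 1 + 2 := ⟨n - 3, by omega⟩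
  obtain rfl : γ 1 = φ₁ := toMap_injective h1
  have hγ0 : γ 0 = 0 := toMap_injective (by
    rw [h0]
    funext x
    exact (add_zero x).symm)
  have hu := isUnit_E hφ₁
  have hF : Hs (m + 1) (D (γ 1)) := (H02.memH_D hreg.of_toMap).hs
  obtain ⟨g, hg, hFg⟩ := hF.exists_contDiffOn
  have hE : ContDiffOn ℝ (m + 1 : ℕ) (ext (E (D (γ 1)))) (Icc 0 1) := by
    refine contDiffOn_succ_of_hasDerivWithinAt (f' := g) (fun x hx => ?_) hg
    have e : ∀ x ∈ Icc (0 : ℝ) 1, ext (E (D (γ 1))) x = 1 + ∫ y in (0 : ℝ)..x, g y := by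
      intro x hx
      rw [ext_E, ext_V _ hx, integral_congr_μI hFg hx]
    exact ((hasDerivWithinAt_primitive hg.continuousOn hx).const_add 1).congr e (e x hx)
  have hR : ContDiffOn ℝ (m + 1 : ℕ) (ext (R (D (γ 1)))) (Icc 0 1) :=
    (hE.inv fun x _ => ext_E_ne_zero hu x).congr fun x _ => ext_R hu x
  have hRg : ContDiffOn ℝ m (fun x => ext (R (D (γ 1))) x * g x) (Icc 0 1) :=
    (hR.of_le (by exact_mod_cast m.le_succ)).mul hg
  obtain ⟨p, hp⟩ := exists_CI_eq hRg.continuousOn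
  have hpae : (fun x => ext (R (D (γ 1))) x * D (γ 1) x) =ᵐ[μI] ext p := by
    filter_upwards [hFg, ae_of_forall_Icc hp] with x h h'
    rw [h, h']
  have hRp : R (D (γ 1)) • D (γ 1) = ι p :=
    Lp.ext ((coeFn_smulCI _ _).trans (hpae.trans (coeFn_ι p).symm))
  -- As a classical function p is only C^m, which drives the bootstrap; its Sobolev order m + 1 is
  -- kept for the final formula.
  have hps : Hs (m + 1) (ext p) := (hF.contDiffOn_mul hR).congr hpae
  obtain ⟨e, q, τ, η, r, v, z, hv, hode, halg⟩ := hγ.exists_ode hγ0 hRp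
  obtain ⟨he, hτ⟩ := contDiffOn_of_ode hode halg (hRg.congr hp)
  have hα : ContDiffOn ℝ (m + 1 : ℕ) (fun x => J (e x * τ x) pt1) (Icc 0 1) :=
    ((ContinuousMap.evalCLM ℝ pt1).comp J).contDiff.comp_contDiffOn (he.mul hτ)
  have hβ : ContDiffOn ℝ (m + 1 : ℕ) (fun x => J (e x) pt1) (Icc 0 1) :=
    ((ContinuousMap.evalCLM ℝ pt1).comp J).contDiff.comp_contDiffOn he
  -- In v = (p - α) / β, both α and β are C^{m+1} by the bootstrap, so v inherits the Sobolev order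
  -- of p.
  have hvs : Hs (m + 1) (ext v) := by
    refine ((hps.add (hs_of_contDiffOn hα.neg)).contDiffOn_mul
      (hβ.inv fun x hx => (halg x hx).1)).congr (ae_of_forall_Icc fun x hx => ?_)
    obtain ⟨ha, hb⟩ := halg x hx
    change (J (e x) pt1)⁻¹ * (ext p x + -J (e x * τ x) pt1) = ext v x
    rw [← hb, add_neg_cancel_right, inv_mul_cancel_left₀ ha]
  refine H02.memH_of_D (Hs.memH ?_)
  rw [hv]
  exact hvs.congr (coeFn_ι v).symm

end

end SobolevDiff

theorem mainTheorem7 (n : ℕ) (hn : 3 ≤ n)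
    (φ₁ : SobolevDiff.H02) (hφ₁ : φ₁ ∈ SobolevDiff.Diff02)
    (hreg : SobolevDiff.MemH n (SobolevDiff.toMap φ₁))
    (γ : ℝ → SobolevDiff.H02) (hγ : SobolevDiff.IsGeodesic γ)
    (h0 : SobolevDiff.toMap (γ 0) = id)
    (h1 : SobolevDiff.toMap (γ 1) = SobolevDiff.toMap φ₁) :
    SobolevDiff.MemH n (SobolevDiff.velocity γ 0) :=
  hγ.memH_velocity_zero hn hφ₁ hreg h0 h1
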